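/- All graphs are finite, simple and undirected. A *pattern* is a connected graph $H$ with $|V(H)|\ge 2$. A *clique separator* of $H$ is a (possibly empty) set $C\subsetneq V(H)$ such that $H[C]$ is a clique and $H[V(H)\setminus C]$ is disconnected. Two sets $A,B\subseteq V(H)$ *touch* if $A\cap B\neq\emptyset$ or there is an edge $\{a,b\}\in E(H)$ with $a\in A$ and $b\in B$. An *embedding* $\psi\colon K_k\to H$ assigns to every node $u$ of the clique $K_k$ a non-empty set $\psi(u)\subseteq V(H)$ such that every $H[\psi(u)]$ is connected and $\psi(u),\psi(v)$ touch for all $u,v\in V(K_k)$. Its *weak edge depth* is $$\mathrm{wed}(\psi)=\max_{\{a,b\}\in E(H)}\bigl|\{u\in V(K_k):\{a,b\}\cap\psi(u)\neq\emptyset\}\bigr|,$$ and the *clique embedding power* of $H$ is $\mathrm{clemb}(H)=\sup_{k\ge 3}\max_{\psi\colon K_k\to H}\frac{k}{\mathrm{wed}(\psi)}$. For $k\ge 1$ and positive integers $\ell_1,\dots,\ell_k$, at most one of which equals $1$, the *$P$-graph* $P(\ell_1,\dots,\ell_k)$ is obtained from paths with $\ell_1,\dots,\ell_k$ edges by identifying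 all their start nodes and identifying all their end nodes. **Lemma.** Let $H$ be a pattern that has no clique separator. Then $\mathrm{clemb}(H)\ge 2$, or $H$ is a $P$-graph, i.e. $H$ is isomorphic to $P(\ell_1,\dots,\ell_k)$ for some $k\ge 1$ and some integers $\ell_1,\dots,\ell_k\ge 1$, at most one of which equals $1$. -/

import Mathlib

open scoped ENNReal

namespace CliqueEmb

universe u

/-- A pattern graph: a connected graph with at least two nodes (finiteness of the node set
is a separate type-class assumption wherever patterns are used). -/
structure IsPattern {V : Type u} (H : SimpleGraph V) : Prop where
  connected : H.Connected
  two_le_card : 2 ≤ Nat.card V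

/-- `C` is a clique separator of `H`: a proper (possibly empty) subset of the nodes that is
a clique and whose complement induces a disconnected graph. -/
def IsCliqueSeparator {V : Type u} (H : SimpleGraph V) (C : Set V) : Prop :=
  C ⊂ Set.univ ∧ H.IsClique C ∧ ¬ (H.induce Cᶜ).Connected

/-- Two node sets touch if they intersect or are joined by an edge. -/
def Touch {V : Type u} (H : SimpleGraph V) (A B : Set V) : Prop :=
  (A ∩ B).Nonempty ∨ ∃ a ∈ A, ∃ b ∈ B, H.Adj a b

/-- An embedding from the clique `K_k`, with node set `Fin k`, to `H`.
Connectedness of an induced subgraph includes that the set is non-empty. -/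
structure CliqueEmbedding {V : Type u} (H : SimpleGraph V) (k : ℕ) where
  toFun : Fin k → Set V
  connected : ∀ x, (H.induce (toFun x)).Connected
  touch : ∀ x y, Touch H (toFun x) (toFun y)

/-- The weak depth of an edge `e`: the number of clique nodes whose image contains
an endpoint of `e`. -/
noncomputable def weakDepth {V : Type u} {H : SimpleGraph V} {k : ℕ}
    (ψ : CliqueEmbedding H k) (e : Sym2 V) : ℕ :=
  {x : Fin k | ∃ a ∈ e, a ∈ ψ.toFun x}.ncard

/-- The weak edge depth of an embedding: the maximum of the weak depths of the edges of `H`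
(weak depths are at most `k`, so this supremum is an honest maximum). -/
noncomputable def weakEdgeDepth {V : Type u} {H : SimpleGraph V} {k : ℕ}
    (ψ : CliqueEmbedding H k) : ℕ :=
  ⨆ e : H.edgeSet, weakDepth ψ (e : Sym2 V)

/-- The clique embedding power of `H`: the supremum of `k / wed(ψ)` over all `k ≥ 3` and all
embeddings `ψ` from `K_k` to `H`, as an extended nonnegative real. -/
noncomputable def clemb {V : Type u} (H : SimpleGraph V) : ℝ≥0∞ :=
  ⨆ (k : ℕ) (_ : 3 ≤ k) (ψ : CliqueEmbedding H k), (k : ℝ≥0∞) / (weakEdgeDepth ψ : ℝ≥0∞)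

/-- The nodes of `P(ℓ_1, …, ℓ_k)`: the common start node, the common end node, and, for each `i`,
the inner nodes of the `i`-th path at positions `0 < j < ℓ_i`. -/
inductive PNode {k : ℕ} (ℓ : Fin k → ℕ) : Type
  | start : PNode ℓ
  | finish : PNode ℓ
  | inner (i : Fin k) (j : ℕ) (hj : 0 < j ∧ j < ℓ i) : PNode ℓ

/-- The node at position `j` (for `0 ≤ j ≤ ℓ_i`) of the `i`-th path. -/
def pathNode {k : ℕ} (ℓ : Fin k → ℕ) (i : Fin k) (j : ℕ) : PNode ℓ :=
  if h0 : j = 0 then PNode.start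
  else if h : j < ℓ i then PNode.inner i j ⟨Nat.pos_of_ne_zero h0, h⟩
  else PNode.finish

/-- The graph `P(ℓ_1, …, ℓ_k)`: its edges join the consecutive nodes of each of the paths,
of lengths `ℓ_1, …, ℓ_k`. -/
def pGraph {k : ℕ} (ℓ : Fin k → ℕ) : SimpleGraph (PNode ℓ) :=
  SimpleGraph.fromRel fun u v =>
    ∃ i : Fin k, ∃ j : ℕ, j < ℓ i ∧ u = pathNode ℓ i j ∧ v = pathNode ℓ i (j + 1)

/-- `H` is a `P`-graph: it is isomorphic to `P(ℓ_1, …, ℓ_k)` for some `k ≥ 1` and positive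
integers `ℓ_1, …, ℓ_k`, at most one of which equals 1. -/
def IsPGraph {V : Type u} (H : SimpleGraph V) : Prop :=
  ∃ (k : ℕ) (ℓ : Fin k → ℕ), 1 ≤ k ∧ (∀ i, 1 ≤ ℓ i) ∧
    (∀ i j, ℓ i = 1 → ℓ j = 1 → i = j) ∧ Nonempty (H ≃g pGraph ℓ)

end CliqueEmb

/-!
The four-vertex clique already suffices as a source of embeddings. Suppose four connected sets
`A`, `D`, `U₁`, `U₂` touch pairwise, `A` and `D` are disjoint from each other and from `U₁ ∪ U₂`,
and no edge joins `U₁ ∩ U₂` to `A ∪ D`. Then every edge meets at most two of them, which gives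
`clemb H ≥ 4 / 2`. Such a half embedding (`HasHalfEmbedding`) generalizes a `K_4`-minor, and it
passes from induced subgraphs and from contractions to the whole graph. So it suffices to
show that a graph without clique separator and without half embedding has at most two vertices of
degree other than two (`hasHalfEmbedding_or_twoBranch`), and that such a graph is a `P`-graph
(`exists_isPathSystem`, `IsPathSystem.isPGraph`).

For the first claim, consider a smallest counterexample. As it has no `K_4`-minor, it has a vertex
`z` of degree two (`exists_degree_le_two`); its neighbours `c` and `d` are not adjacent, as they
would form a clique separator. Contracting an edge at a vertex of degree two suppresses this vertex
and keeps all other degrees, so by minimality the contraction must have a clique separator. Without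
a `K_4`-minor this is possible only if the two neighbours of the vertex separate the rest of the
graph (`NoCliqueSep.merge`, `Unsuppressible`). In particular, the graph without `c` and `d` has at
least three components: `{z}`, a component `X` with a vertex of larger degree, and another
component `Y`. By minimality, the graph induced by `X`, `c`, `d`, `z` has only two branch vertices
`a` and `b`. Since vertices of degree two cannot be suppressed, there is hardly any freedom left: up
to symmetry, `d` is adjacent to `a`, the vertex `c` is equal or adjacent to `b`, the vertices `a`
and `b` are not adjacent, and `X` contains two common neighbours `p`, `q` of them. Then `{a}`,
`{d}`, `{b, c, p, z}`, `{b, c, q} ∪ Y` is a half embedding (`Lobe.hasHalfEmbedding`).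

The second claim is again an induction by contraction: a neighbour of `a` of degree two either is
a path of length two from `a` to `b` by itself, or subdivides the first edge of a path.

Connectedness is expressed by cuts (`Linked`) and contraction is carried out on a fixed vertex type
(`merge`), with a set `S` of active vertices, so that neither walks nor quotients are needed.
-/

namespace CliqueEmb

variable {V : Type*} {H : SimpleGraph V} {S T A B X Y : Set V} {a b c d x y z : V}

/-! ### Connected vertex sets -/

/-- `T` is a union of connected components of the subgraph induced by `S`: no edge inside `S`
leaves `T`. -/
def ClosedIn (H : SimpleGraph V) (S T : Set V) : Prop :=
  ∀ a ∈ T, ∀ b ∈ S, H.Adj a b → b ∈ T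

/-- The subgraph of `H` induced by `S` is connected, phrased through cuts: `S` is non-empty and
the only non-empty subset of `S` that no edge inside `S` leaves is `S` itself. -/
def Linked (H : SimpleGraph V) (S : Set V) : Prop :=
  S.Nonempty ∧ ∀ T ⊆ S, T.Nonempty → ClosedIn H S T → S ⊆ T

theorem linked_iff_connected : Linked H S ↔ (H.induce S).Connected := by
  constructor
  · rintro ⟨⟨s, hs⟩, h⟩
    have : Nonempty S := ⟨⟨s, hs⟩⟩
    refine ⟨fun u v => ?_⟩
    have := h {w | ∃ hw : w ∈ S, (H.induce S).Reachable u ⟨w, hw⟩} (fun w hw => hw.1)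
      ⟨u, u.2, SimpleGraph.Reachable.refl _⟩ (by
        rintro a ⟨ha, hra⟩ b hb hab
        exact ⟨hb, hra.trans (SimpleGraph.Adj.reachable (by simpa using hab))⟩) v.2
    exact this.2
  · intro h
    obtain ⟨⟨s, hs⟩⟩ := h.nonempty
    refine ⟨⟨s, hs⟩, fun T hT ⟨t, ht⟩ hcl v hv => ?_⟩
    obtain ⟨p⟩ := h.preconnected ⟨t, hT ht⟩ ⟨v, hv⟩
    have key : ∀ (x y : S), (H.induce S).Walk x y → (x : V) ∈ T → (y : V) ∈ T := by
      intro x y p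
      induction p with
      | nil => exact id
      | cons hxy _ ih => exact fun hx => ih (hcl _ hx _ (Subtype.prop _) (by simpa using hxy))
    exact key _ _ p ht

theorem linked_singleton (v : V) : Linked H {v} := by
  refine ⟨⟨v, rfl⟩, fun T hT ⟨t, ht⟩ _ => ?_⟩
  have : t = v := hT ht
  subst this
  simpa using ht

/-- Two touching connected sets have a connected union. -/
theorem Linked.union (hA : Linked H A) (hB : Linked H B) (h : Touch H A B) :
    Linked H (A ∪ B) := by
  refine ⟨hA.1.mono Set.subset_union_left, fun T hT ⟨t, ht⟩ hcl => ?_⟩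
  have hA' : (T ∩ A).Nonempty → A ⊆ T := fun hne => fun v hv =>
    (hA.2 (T ∩ A) Set.inter_subset_right hne
      (fun a ha b hb hab => ⟨hcl a ha.1 b (Or.inl hb) hab, hb⟩) hv).1
  have hB' : (T ∩ B).Nonempty → B ⊆ T := fun hne => fun v hv =>
    (hB.2 (T ∩ B) Set.inter_subset_right hne
      (fun a ha b hb hab => ⟨hcl a ha.1 b (Or.inr hb) hab, hb⟩) hv).1
  have hAB : A ⊆ T → B ⊆ T := fun hAT => by
    rcases h with ⟨x, hxA, hxB⟩ | ⟨a, ha, b, hb, hab⟩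
    · exact hB' ⟨x, hAT hxA, hxB⟩
    · exact hB' ⟨b, hcl a (hAT ha) b (Or.inr hb) hab, hb⟩
  have hBA : B ⊆ T → A ⊆ T := fun hBT => by
    rcases h with ⟨x, hxA, hxB⟩ | ⟨a, ha, b, hb, hab⟩
    · exact hA' ⟨x, hBT hxB, hxA⟩
    · exact hA' ⟨a, hcl b (hBT hb) a (Or.inl ha) hab.symm, ha⟩
  rcases hT ht with htA | htB
  · have := hA' ⟨t, ht, htA⟩
    exact Set.union_subset this (hAB this)
  · have := hB' ⟨t, ht, htB⟩
    exact Set.union_subset (hBA this) this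

theorem Linked.exists_adj (hS : Linked H S) (hTS : T ⊆ S) (hT : T.Nonempty) {v : V} (hv : v ∈ S)
    (hvT : v ∉ T) : ∃ a ∈ T, ∃ b ∈ S, b ∉ T ∧ H.Adj a b := by
  by_contra! h
  exact hvT (hS.2 T hTS hT (fun a ha b hb hab => by_contra fun hbT => h a ha b hb hbT hab) hv)

/-- `C` is the connected component of `v` in the subgraph induced by `S`. -/
theorem exists_component (H : SimpleGraph V) {v : V} (hv : v ∈ S) :
    ∃ C ⊆ S, v ∈ C ∧ Linked H C ∧ ClosedIn H S C := by
  let C : Set V := {w | w ∈ S ∧ ∀ T ⊆ S, v ∈ T → ClosedIn H S T → w ∈ T}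
  have hvC : v ∈ C := ⟨hv, fun T _ h _ => h⟩
  have hcl : ClosedIn H S C := fun a ha b hb hab =>
    ⟨hb, fun T hT hvT hTc => hTc a (ha.2 T hT hvT hTc) b hb hab⟩
  refine ⟨C, fun w hw => hw.1, hvC, ⟨⟨v, hvC⟩, fun T hT ⟨t, ht⟩ hTc => ?_⟩, hcl⟩
  have hTS : ClosedIn H S T := fun a ha b hb hab => hTc a ha b (hcl a (hT ha) b hb hab) hab
  by_cases hvT : v ∈ T
  · exact fun w hw => hw.2 T (fun x hx => (hT hx).1) hvT hTS
  · exfalso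
    refine ((hT ht).2 (S \ T) Set.sdiff_subset ⟨hv, hvT⟩ ?_).2 ht
    exact fun a ha b hb hab => ⟨hb, fun hbT => ha.2 (hTS b hbT a ha.1 hab.symm)⟩

theorem not_linked (hne : S.Nonempty) (h : ¬ Linked H S) :
    ∃ T ⊆ S, T.Nonempty ∧ ClosedIn H S T ∧ ∃ v ∈ S, v ∉ T := by
  by_contra! h'
  exact h ⟨hne, fun T hT hTn hc v hv => by_contra fun hvT => hvT (h' T hT hTn hc v hv)⟩

theorem ClosedIn.compl (h : ClosedIn H S T) : ClosedIn H S (S \ T) :=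
  fun a ha b hb hab => ⟨hb, fun hbT => ha.2 (h b hbT a ha.1 hab.symm)⟩

/-- Removing a vertex whose only neighbour in `S` is `d` keeps `S` connected. -/
theorem Linked.remove_leaf (hS : Linked H S) {z d : V} (hd : d ∈ S) (hdz : d ≠ z)
    (hz : ∀ w ∈ S, H.Adj z w → w = d) : Linked H (S \ {z}) := by
  refine ⟨⟨d, hd, hdz⟩, fun T hT hTn hcl => ?_⟩
  have hzT : z ∉ T := fun h => (hT h).2 rfl
  by_cases hdT : d ∈ T
  · by_cases hzS : z ∈ S
    · have := hS.2 (insert z T) (Set.insert_subset hzS fun x hx => (hT hx).1) ⟨z, Or.inl rfl⟩ (by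
        rintro a (rfl | ha) b hb hab
        · exact Or.inr (hz b hb hab ▸ hdT)
        · by_cases hbz : b = z
          · exact Or.inl hbz
          · exact Or.inr (hcl a ha b ⟨hb, hbz⟩ hab))
      exact fun x hx => (this hx.1).resolve_left hx.2
    · exact fun x hx => hS.2 T (fun x hx => (hT hx).1) hTn (fun a ha b hb hab =>
        hcl a ha b ⟨hb, fun h => hzS (h ▸ hb)⟩ hab) hx.1
  · exact fun x hx => hS.2 T (fun x hx => (hT hx).1) hTn (fun a ha b hb hab => by
        by_cases hbz : b = z
        · subst hbz
          exact absurd (hz a (hT ha).1 hab.symm ▸ ha) hdT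
        · exact hcl a ha b ⟨hb, hbz⟩ hab) hx.1

theorem Linked.congr {H' : SimpleGraph V} (hS : Linked H S)
    (h : ∀ a ∈ S, ∀ b ∈ S, H.Adj a b → H'.Adj a b) : Linked H' S :=
  ⟨hS.1, fun T hT hTn hcl => hS.2 T hT hTn fun a ha b hb hab =>
    hcl a ha b hb (h a (hT ha) b hb hab)⟩

/-! ### Contracting an edge -/

/-- The vertex `x` additionally receives all neighbours of `y`. On a set `S \ {y}` this is the
contraction of the edge `xy`; the vertex type is kept, so that no quotient is needed. -/
def merge (H : SimpleGraph V) (x y : V) : SimpleGraph V where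
  Adj u v := H.Adj u v ∨ (u = x ∧ v ≠ x ∧ H.Adj y v) ∨ (v = x ∧ u ≠ x ∧ H.Adj y u)
  symm := ⟨by
    rintro u v (h | h | h)
    · exact Or.inl h.symm
    · exact Or.inr (Or.inr h)
    · exact Or.inr (Or.inl h)⟩
  loopless := ⟨by
    rintro u (h | h | h)
    · exact H.loopless.irrefl u h
    · exact h.2.1 h.1
    · exact h.2.1 h.1⟩

theorem Linked.contract (hS : Linked H S) (hx : x ∈ S) (hxy : H.Adj x y) :
    Linked (merge H x y) (S \ {y}) := by
  refine ⟨⟨x, hx, hxy.ne⟩, fun T hT hTn hcl => ?_⟩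
  have := hS.2 (T ∪ {v | v = y ∧ y ∈ S ∧ x ∈ T})
    (Set.union_subset (fun v hv => (hT hv).1) (by rintro v ⟨rfl, h, _⟩; exact h))
    (hTn.mono Set.subset_union_left) (by
      rintro a (ha | ⟨rfl, haS, hxT⟩) b hb hab
      · by_cases hby : b = y
        · subst hby
          refine Or.inr ⟨rfl, hb, ?_⟩
          by_cases hax : a = x
          · exact hax ▸ ha
          · exact hcl a ha x ⟨hx, hxy.ne⟩ (Or.inr (Or.inr ⟨rfl, hax, hab.symm⟩))
        · exact Or.inl (hcl a ha b ⟨hb, hby⟩ (Or.inl hab))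
      · by_cases hbx : b = x
        · exact Or.inl (hbx ▸ hxT)
        · exact Or.inl (hcl x hxT b ⟨hb, hab.ne'⟩ (Or.inr (Or.inl ⟨rfl, hbx, hab⟩))))
  exact fun v hv => (this hv.1).resolve_right fun h => hv.2 h.1

/-- The preimage of `T` under the contraction of `y` into `x`. -/
def lift (x y : V) (T : Set V) : Set V := T ∪ {v | v = y ∧ x ∈ T}

theorem subset_lift : T ⊆ lift x y T := Set.subset_union_left

theorem Linked.preimage (hT : Linked (merge H x y) T) (hy : y ∉ T) (hxy : H.Adj x y) :
    Linked H (lift x y T) := by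
  refine ⟨hT.1.mono subset_lift, fun W hW hWn hcl => ?_⟩
  have hyx : y ∈ W → x ∈ W := fun h => by
    rcases hW h with h' | h'
    · exact absurd h' hy
    · exact hcl y h x (Or.inl h'.2) hxy.symm
  have hWT : T ⊆ W := by
    have := hT.2 (W ∩ T) Set.inter_subset_right (by
      obtain ⟨w, hw⟩ := hWn
      rcases hW hw with h' | ⟨rfl, h'⟩
      · exact ⟨w, hw, h'⟩
      · exact ⟨x, hyx hw, h'⟩) (by
      rintro a ⟨haW, haT⟩ b hb (hab | ⟨rfl, -, hab⟩ | ⟨rfl, -, hab⟩)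
      · exact ⟨hcl a haW b (Or.inl hb) hab, hb⟩
      · exact ⟨hcl y (hcl a haW y (Or.inr ⟨rfl, haT⟩) hxy) b (Or.inl hb) hab, hb⟩
      · exact ⟨hyx (hcl a haW y (Or.inr ⟨rfl, hb⟩) hab.symm), hb⟩)
    exact fun v hv => (this hv).1
  rintro v (hv | ⟨rfl, hv⟩)
  · exact hWT hv
  · exact hcl x (hWT hv) v (Or.inr ⟨rfl, hv⟩) hxy

/-! ### The embeddings of `K_4` -/

/-- Four connected sets inside `S` that touch pairwise, such that `A` and `D` are disjoint from
each other and from `U₁ ∪ U₂`, and no edge joins `U₁ ∩ U₂` to `A ∪ D`. Then every edge meets at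
most two of the four sets, so this is an embedding of `K_4` of weak edge depth at most `2`.
Taking `U₁ ∩ U₂ = ∅` gives exactly the `K_4`-minors. -/
def HasHalfEmbedding (H : SimpleGraph V) (S : Set V) : Prop :=
  ∃ A D U₁ U₂ : Set V, (A ⊆ S ∧ D ⊆ S ∧ U₁ ⊆ S ∧ U₂ ⊆ S) ∧
    (Linked H A ∧ Linked H D ∧ Linked H U₁ ∧ Linked H U₂) ∧
    (Disjoint A D ∧ Disjoint A U₁ ∧ Disjoint A U₂ ∧ Disjoint D U₁ ∧ Disjoint D U₂) ∧
    (Touch H A D ∧ Touch H A U₁ ∧ Touch H A U₂ ∧ Touch H D U₁ ∧ Touch H D U₂ ∧ Touch H U₁ U₂) ∧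
    ∀ m ∈ U₁ ∩ U₂, ∀ v ∈ A ∪ D, ¬ H.Adj m v

theorem HasHalfEmbedding.mono (h : HasHalfEmbedding H T) (hTS : T ⊆ S) :
    HasHalfEmbedding H S := by
  obtain ⟨A, D, U₁, U₂, ⟨h1, h2, h3, h4⟩, h⟩ := h
  exact ⟨A, D, U₁, U₂, ⟨h1.trans hTS, h2.trans hTS, h3.trans hTS, h4.trans hTS⟩, h⟩

theorem Touch.preimage (h : Touch (merge H x y) A B) : Touch H (lift x y A) (lift x y B) := by
  rcases h with ⟨v, hA, hB⟩ | ⟨a, ha, b, hb, hab | ⟨rfl, -, hab⟩ | ⟨rfl, -, hab⟩⟩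
  · exact Or.inl ⟨v, Or.inl hA, Or.inl hB⟩
  · exact Or.inr ⟨a, Or.inl ha, b, Or.inl hb, hab⟩
  · exact Or.inr ⟨y, Or.inr ⟨rfl, ha⟩, b, Or.inl hb, hab⟩
  · exact Or.inr ⟨a, Or.inl ha, y, Or.inr ⟨rfl, hb⟩, hab.symm⟩

theorem disjoint_lift (hA : y ∉ A) (hB : y ∉ B) (h : Disjoint A B) :
    Disjoint (lift x y A) (lift x y B) := by
  rw [Set.disjoint_left] at h ⊢
  rintro v (hv | ⟨hvy, hv⟩) (hv' | ⟨hvy', hv'⟩)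
  · exact h hv hv'
  · exact hA (hvy' ▸ hv)
  · exact hB (hvy ▸ hv')
  · exact h hv hv'

theorem HasHalfEmbedding.of_merge (hy : y ∈ S) (hxy : H.Adj x y)
    (h : HasHalfEmbedding (merge H x y) (S \ {y})) : HasHalfEmbedding H S := by
  obtain ⟨A, D, U₁, U₂, ⟨h1, h2, h3, h4⟩, ⟨l1, l2, l3, l4⟩, ⟨d1, d2, d3, d4, d5⟩,
    ⟨t1, t2, t3, t4, t5, t6⟩, hno⟩ := h
  have hsub : ∀ {T : Set V}, T ⊆ S \ {y} → lift x y T ⊆ S := fun hT v hv => by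
    rcases hv with hv | ⟨rfl, -⟩
    · exact (hT hv).1
    · exact hy
  have hny : ∀ {T : Set V}, T ⊆ S \ {y} → y ∉ T := fun hT hyT => (hT hyT).2 rfl
  refine ⟨lift x y A, lift x y D, lift x y U₁, lift x y U₂, ⟨hsub h1, hsub h2, hsub h3, hsub h4⟩,
    ⟨l1.preimage (hny h1) hxy, l2.preimage (hny h2) hxy, l3.preimage (hny h3) hxy,
      l4.preimage (hny h4) hxy⟩,
    ⟨disjoint_lift (hny h1) (hny h2) d1, disjoint_lift (hny h1) (hny h3) d2,
      disjoint_lift (hny h1) (hny h4) d3, disjoint_lift (hny h2) (hny h3) d4,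
      disjoint_lift (hny h2) (hny h4) d5⟩,
    ⟨t1.preimage, t2.preimage, t3.preimage, t4.preimage, t5.preimage, t6.preimage⟩, ?_⟩
  have hm : ∀ m ∈ lift x y U₁ ∩ lift x y U₂, m ∈ U₁ ∩ U₂ ∨ (m = y ∧ x ∈ U₁ ∩ U₂) := by
    rintro m ⟨hm | hm, hm' | hm'⟩
    · exact Or.inl ⟨hm, hm'⟩
    · exact absurd (hm'.1 ▸ hm) (hny h3)
    · exact absurd (hm.1 ▸ hm') (hny h4)
    · exact Or.inr ⟨hm.1, hm.2, hm'.2⟩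
  have hv' : ∀ v ∈ lift x y A ∪ lift x y D, v ∈ A ∪ D ∨ (v = y ∧ x ∈ A ∪ D) := by
    rintro v ((hv | hv) | (hv | hv))
    · exact Or.inl (Or.inl hv)
    · exact Or.inr ⟨hv.1, Or.inl hv.2⟩
    · exact Or.inl (Or.inr hv)
    · exact Or.inr ⟨hv.1, Or.inr hv.2⟩
  have hdisj : ∀ v ∈ A ∪ D, v ∉ U₁ := by
    rintro v (hv | hv) hv'
    · exact Set.disjoint_left.1 d2 hv hv'
    · exact Set.disjoint_left.1 d4 hv hv'
  intro m hm1 v hv1 hadj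
  rcases hm m hm1 with hm2 | ⟨rfl, hm2⟩ <;> rcases hv' v hv1 with hv2 | ⟨rfl, hv2⟩
  · exact hno m hm2 v hv2 (Or.inl hadj)
  · exact hno m hm2 x hv2 (Or.inr (Or.inr ⟨rfl, fun h => hdisj x hv2 (h ▸ hm2.1), hadj.symm⟩))
  · exact hno x hm2 v hv2 (Or.inr (Or.inl ⟨rfl, fun h => hdisj x (h ▸ hv2) hm2.1, hadj⟩))
  · exact H.loopless.irrefl _ hadj

theorem Touch.of_adj {a b : V} (ha : a ∈ A) (hb : b ∈ B) (h : H.Adj a b) : Touch H A B :=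
  Or.inr ⟨a, ha, b, hb, h⟩

theorem Touch.symm (h : Touch H A B) : Touch H B A := by
  rcases h with ⟨v, hA, hB⟩ | ⟨a, ha, b, hb, hab⟩
  · exact Or.inl ⟨v, hB, hA⟩
  · exact Or.inr ⟨b, hb, a, ha, hab.symm⟩

theorem Linked.touch_self (h : Linked H A) : Touch H A A :=
  let ⟨v, hv⟩ := h.1
  Or.inl ⟨v, hv, hv⟩

theorem HasHalfEmbedding.two_le_clemb (h : HasHalfEmbedding H S) : 2 ≤ clemb H := by
  obtain ⟨A, D, U₁, U₂, -, ⟨l1, l2, l3, l4⟩, ⟨d1, d2, d3, d4, d5⟩,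
    ⟨t1, t2, t3, t4, t5, t6⟩, hno⟩ := h
  let ψ : CliqueEmbedding H 4 :=
    { toFun := ![A, D, U₁, U₂]
      connected := by
        intro i
        fin_cases i
        · exact linked_iff_connected.1 l1
        · exact linked_iff_connected.1 l2
        · exact linked_iff_connected.1 l3
        · exact linked_iff_connected.1 l4
      touch := by
        intro i j
        fin_cases i <;> fin_cases j <;> dsimp
        · exact l1.touch_self
        · exact t1
        · exact t2
        · exact t3
        · exact t1.symm
        · exact l2.touch_self
        · exact t4
        · exact t5
        · exact t2.symm
        · exact t4.symm
        · exact l3.touch_self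
        · exact t6
        · exact t3.symm
        · exact t5.symm
        · exact t6.symm
        · exact l4.touch_self }
  have hdepth : ∀ e : H.edgeSet, weakDepth ψ (e : Sym2 V) ≤ 2 := by
    rintro ⟨e, he⟩
    induction e using Sym2.ind with
    | _ u v =>
    rw [SimpleGraph.mem_edgeSet] at he
    rw [Set.disjoint_left] at d1 d2 d3 d4 d5
    have hpair : ∀ i j : Fin 4, {i' : Fin 4 | ∃ a ∈ s(u, v), a ∈ ψ.toFun i'} ⊆ {i, j} →
        weakDepth ψ s(u, v) ≤ 2 := fun i j hij =>
      (Set.ncard_le_ncard hij).trans (by simpa using Set.ncard_insert_le i {j})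
    have hp : ∀ i : Fin 4, (∃ a ∈ s(u, v), a ∈ ψ.toFun i) ↔ (u ∈ ψ.toFun i ∨ v ∈ ψ.toFun i) := by
      simp
    have h2 : ψ.toFun 2 = U₁ := rfl
    have h3 : ψ.toFun 3 = U₂ := rfl
    have huv := hno u
    have hvu := hno v
    -- an endpoint in `A ∪ D` meets one set only and its neighbours at most one more;
    -- without such an endpoint only `U₁` and `U₂` can be met
    have hall : ∀ P : Fin 4 → Prop, P 0 → P 1 → P 2 → P 3 → ∀ k, P k := fun P p0 p1 p2 p3 k => by
      fin_cases k
      exacts [p0, p1, p2, p3]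
    have key : ∃ i j : Fin 4, ∀ k : Fin 4, k ≠ i → k ≠ j →
        ¬ (u ∈ ψ.toFun k ∨ v ∈ ψ.toFun k) := by
      by_cases hA : u ∈ A ∨ v ∈ A
      · by_cases hD : u ∈ D ∨ v ∈ D
        · exact ⟨0, 1, hall _ (fun h _ => absurd rfl h) (fun _ h => absurd rfl h)
            (fun _ _ => by rw [h2]; grind) (fun _ _ => by rw [h3]; grind)⟩
        · by_cases hU : u ∈ U₁ ∨ v ∈ U₁
          · exact ⟨0, 2, hall _ (fun h _ => absurd rfl h) (fun _ _ => hD)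
              (fun _ h => absurd rfl h) (fun _ _ => by rw [h3]; grind [H.adj_comm])⟩
          · exact ⟨0, 3, hall _ (fun h _ => absurd rfl h) (fun _ _ => hD) (fun _ _ => hU)
              (fun _ h => absurd rfl h)⟩
      · by_cases hD : u ∈ D ∨ v ∈ D
        · by_cases hU : u ∈ U₁ ∨ v ∈ U₁
          · exact ⟨1, 2, hall _ (fun _ _ => hA) (fun h _ => absurd rfl h)
              (fun _ h => absurd rfl h) (fun _ _ => by rw [h3]; grind [H.adj_comm])⟩
          · exact ⟨1, 3, hall _ (fun _ _ => hA) (fun h _ => absurd rfl h) (fun _ _ => hU)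
              (fun _ h => absurd rfl h)⟩
        · exact ⟨2, 3, hall _ (fun _ _ => hA) (fun _ _ => hD) (fun h _ => absurd rfl h)
            (fun _ h => absurd rfl h)⟩
    obtain ⟨i, j, hij⟩ := key
    refine hpair i j fun k hk => ?_
    by_contra hne
    simp only [Set.mem_insert_iff, Set.mem_singleton_iff, not_or] at hne
    exact hij k hne.1 hne.2 ((hp k).1 hk)
  have hwed : weakEdgeDepth ψ ≤ 2 := by
    unfold weakEdgeDepth
    rcases isEmpty_or_nonempty H.edgeSet with hE | hE
    · simp
    · exact ciSup_le hdepth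
  calc (2 : ℝ≥0∞) = 4 / 2 := by
        rw [ENNReal.eq_div_iff] <;> norm_num
    _ ≤ ((4 : ℕ) : ℝ≥0∞) / (weakEdgeDepth ψ : ℝ≥0∞) := by
        push_cast
        exact ENNReal.div_le_div_left (by exact_mod_cast hwed) _
    _ ≤ clemb H := le_iSup_of_le 4 (le_iSup_of_le (by norm_num) (le_iSup_of_le ψ le_rfl))

/-- Two adjacent vertices with two common neighbours that are connected outside of them yield
a `K_4`-minor. -/
theorem hasHalfEmbedding_of_common_neighbors {R : Set V} (hR : Linked H R) (hRS : R ⊆ S)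
    (hx : x ∈ S) (hy : y ∈ S) (hxR : x ∉ R) (hyR : y ∉ R) (hxy : H.Adj x y) {u v : V}
    (hu : u ∈ R) (hv : v ∈ R) (huv : u ≠ v) (hxu : H.Adj x u) (hyu : H.Adj y u)
    (hxv : H.Adj x v) (hyv : H.Adj y v) : HasHalfEmbedding H S := by
  obtain ⟨C, hCR, hvC, hC, hcl⟩ := exists_component H (S := R \ {u}) ⟨hv, huv.symm⟩
  have huC : u ∉ C := fun h => (hCR h).2 rfl
  obtain ⟨a, ha, b, hb, hbC, hab⟩ :=
    hR.exists_adj (fun w hw => (hCR hw).1) ⟨v, hvC⟩ hu huC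
  -- the component `C` of `v` in `R \ {u}` can only be left through `u`
  have hbu : b = u := by_contra fun h => hbC (hcl a ha b ⟨hb, h⟩ hab)
  subst hbu
  have hxC : x ∉ C := fun h => hxR (hCR h).1
  have hyC : y ∉ C := fun h => hyR (hCR h).1
  refine ⟨{x}, {y}, {b}, C, ⟨by simpa, by simpa, by simpa using hRS hu,
    fun w hw => hRS (hCR hw).1⟩, ⟨linked_singleton _, linked_singleton _, linked_singleton _, hC⟩,
    ⟨by simpa using hxy.ne, by simpa using hxu.ne, by simpa, by simpa using hyu.ne, by simpa⟩,
    ⟨.of_adj rfl rfl hxy, .of_adj rfl rfl hxu, .of_adj rfl hvC hxv, .of_adj rfl rfl hyu,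
      .of_adj rfl hvC hyv, .of_adj rfl ha hab.symm⟩, ?_⟩
  rintro m ⟨rfl, hm⟩
  exact absurd hm huC

/-- In the absence of a half embedding, every edge `xy` of a connected graph on at least three
vertices misses some vertex of degree at most two. If the graph without `x` and `y` is disconnected,
induction applies to a part of it together with `x` and `y`. Otherwise `x` and `y` have at most one
common neighbour `u`, since two of them would give a `K_4`-minor; after contracting `xy`, induction
applies to the edge from the new vertex to `u`, and all vertices off this edge keep their degree. -/
theorem exists_degree_le_two (n : ℕ) : ∀ (H : SimpleGraph V) (S : Set V) (x y : V), S.Finite →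
    S.ncard = n → x ∈ S → y ∈ S → H.Adj x y → (∃ v ∈ S, v ≠ x ∧ v ≠ y) → Linked H S →
    ¬ HasHalfEmbedding H S →
    ∃ v ∈ S, v ≠ x ∧ v ≠ y ∧ ∃ p q, ∀ w ∈ S, H.Adj v w → w = p ∨ w = q := by
  induction n using Nat.strong_induction_on with
  | _ n ih =>
  intro H S x y hfin hn hx hy hxy ⟨t, htS, htx, hty⟩ hS hno
  have hR0 : (S \ {x, y}).Nonempty := ⟨t, htS, by simp [htx, hty]⟩
  by_cases hR : Linked H (S \ {x, y})
  · -- contract `y` into `x`; the other end `u` of the new edge is the only possible common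
    -- neighbour of `x` and `y`
    have huniq : ∀ u ∈ S, ∀ v ∈ S, H.Adj x u → H.Adj y u → H.Adj x v → H.Adj y v → u = v := by
      intro u hu v hv h1 h2 h3 h4
      by_contra huv
      exact hno (hasHalfEmbedding_of_common_neighbors hR Set.sdiff_subset hx hy (by simp)
        (by simp) hxy ⟨hu, by simp [h1.ne', h2.ne']⟩ ⟨hv, by simp [h3.ne', h4.ne']⟩ huv h1 h2 h3 h4)
    have hu : ∃ u ∈ S, u ≠ x ∧ u ≠ y ∧ (H.Adj x u ∨ H.Adj y u) ∧
        ∀ v ∈ S, H.Adj x v → H.Adj y v → v = u := by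
      by_cases hc : ∃ u ∈ S, H.Adj x u ∧ H.Adj y u
      · obtain ⟨u, hu, h1, h2⟩ := hc
        exact ⟨u, hu, h1.ne', h2.ne', Or.inl h1, fun v hv h3 h4 => huniq v hv u hu h3 h4 h1 h2⟩
      · obtain ⟨a, ha, u, hu, huT, hau⟩ := hS.exists_adj (T := {x, y})
          (by simp [Set.insert_subset_iff, hx, hy]) ⟨x, by simp⟩ htS (by simp [htx, hty])
        simp only [Set.mem_insert_iff, Set.mem_singleton_iff, not_or] at huT ha
        refine ⟨u, hu, huT.1, huT.2, ?_, fun v hv h3 h4 => absurd ⟨v, hv, h3, h4⟩ hc⟩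
        rcases ha with rfl | rfl
        · exact Or.inl hau
        · exact Or.inr hau
    obtain ⟨u, huS, hux, huy, hadj, hcom⟩ := hu
    by_cases hthird : ∃ v ∈ S \ {y}, v ≠ x ∧ v ≠ u
    · obtain ⟨v, hv, hvx, hvu, p, q, hpq⟩ := ih (S \ {y}).ncard
        (hn ▸ Set.ncard_sdiff_singleton_lt_of_mem hy hfin) (merge H x y) (S \ {y}) x u
        (hfin.subset Set.sdiff_subset) rfl ⟨hx, hxy.ne⟩ ⟨huS, huy⟩
        (by
          rcases hadj with h | h
          · exact Or.inl h
          · exact Or.inr (Or.inl ⟨rfl, hux, h⟩)) hthird (hS.contract hx hxy)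
        fun h => hno (h.of_merge hy hxy)
      refine ⟨v, hv.1, hvx, hv.2, ?_⟩
      -- `v` is not adjacent to both `x` and `y`
      by_cases hvy : H.Adj v y
      · have hnx : ¬ H.Adj v x := fun h => hvu (hcom v hv.1 h.symm hvy.symm)
        have hx' : x = p ∨ x = q :=
          hpq x ⟨hx, hxy.ne⟩ (Or.inr (Or.inr ⟨rfl, hvx, hvy.symm⟩))
        have key : ∀ w ∈ S, H.Adj v w → w = y ∨ (w ≠ x ∧ (w = p ∨ w = q)) := fun w hw hvw => by
          by_cases hwy : w = y
          · exact Or.inl hwy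
          · exact Or.inr ⟨fun h => hnx (h ▸ hvw), hpq w ⟨hw, hwy⟩ (Or.inl hvw)⟩
        rcases hx' with rfl | rfl
        · exact ⟨y, q, fun w hw hvw => by grind⟩
        · exact ⟨y, p, fun w hw hvw => by grind⟩
      · exact ⟨p, q, fun w hw hvw => hpq w ⟨hw, fun h => hvy (h ▸ hvw)⟩ (Or.inl hvw)⟩
    · push Not at hthird
      refine ⟨u, huS, hux, huy, x, y, fun w hw huw => ?_⟩
      by_contra! h
      exact huw.ne' (hthird w ⟨hw, h.2⟩ h.1)
  · obtain ⟨T, hTR, ⟨t₁, ht₁⟩, hcl, r, hr, hrT⟩ := not_linked hR0 hR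
    -- keep only the closed part `T` together with `x` and `y`
    have hT' : ∀ a ∈ T, ∀ b ∈ S, H.Adj a b → b ∈ T ∪ {x, y} := fun a ha b hb hab => by
      by_cases hbxy : b ∈ ({x, y} : Set V)
      · exact Or.inr hbxy
      · exact Or.inl (hcl a ha b ⟨hb, hbxy⟩ hab)
    have hsub : T ∪ {x, y} ⊆ S := Set.union_subset (fun v hv => (hTR hv).1)
      (by simp [Set.insert_subset_iff, hx, hy])
    have hlink : Linked H (T ∪ {x, y}) := by
      refine ⟨⟨x, by simp⟩, fun W hW hWn hWc => ?_⟩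
      -- a closed set containing one of `x`, `y` extends by everything outside `T`
      have hxy' : x ∈ W ↔ y ∈ W :=
        ⟨fun h => hWc x h y (by simp) hxy, fun h => hWc y h x (by simp) hxy.symm⟩
      by_cases hxW : x ∈ W
      · have := hS.2 (W ∪ {v | v ∈ S ∧ v ∉ T}) (Set.union_subset (hW.trans hsub) fun v hv => hv.1)
          (hWn.mono Set.subset_union_left) (by
            rintro a (ha | ha) b hb hab
            · by_cases hbT : b ∈ T
              · exact Or.inl (hWc a ha b (Or.inl hbT) hab)
              · exact Or.inr ⟨hb, hbT⟩
            · by_cases hbT : b ∈ T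
              · rcases hT' b hbT a ha.1 hab.symm with h | rfl | rfl
                · exact absurd h ha.2
                · exact Or.inl (hWc _ hxW b (Or.inl hbT) hab)
                · exact Or.inl (hWc _ (hxy'.1 hxW) b (Or.inl hbT) hab)
              · exact Or.inr ⟨hb, hbT⟩)
        rintro v (hv | rfl | rfl)
        · exact (this (hTR hv).1).resolve_right fun h => h.2 hv
        · exact hxW
        · exact hxy'.1 hxW
      · have hyW : y ∉ W := fun h => hxW (hxy'.2 h)
        have hWT : W ⊆ T := fun v hv => by
          rcases hW hv with h | rfl | rfl
          · exact h
          · exact absurd hv hxW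
          · exact absurd hv hyW
        exact absurd (hS.2 W (hW.trans hsub) hWn
          (fun a ha b hb hab => hWc a ha b (hT' a (hWT ha) b hb hab) hab) hx) hxW
    have hlt : (T ∪ {x, y}).ncard < n := by
      rw [← hn]
      exact Set.ncard_lt_ncard ⟨hsub, fun h => (h hr.1).elim hrT hr.2⟩ hfin
    obtain ⟨v, hv, hvx, hvy, p, q, hpq⟩ := ih _ hlt H (T ∪ {x, y}) x y (hfin.subset hsub) rfl
      (by simp) (by simp) hxy ⟨t₁, Or.inl ht₁, fun h => (hTR ht₁).2 (by simp [h]),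
        fun h => (hTR ht₁).2 (by simp [h])⟩ hlink fun h => hno (h.mono hsub)
    have hvT : v ∈ T := hv.resolve_right (by simp [hvx, hvy])
    exact ⟨v, hsub hv, hvx, hvy, p, q, fun w hw hvw => hpq w (hT' v hvT w hw hvw) hvw⟩

/-! ### Graphs without clique separators -/

/-- The subgraph induced by `S` has no clique separator. -/
def NoCliqueSep (H : SimpleGraph V) (S : Set V) : Prop :=
  ∀ K ⊆ S, H.IsClique K → K ≠ S → Linked H (S \ K)

/-- The vertices `x ≠ y` are exactly the neighbours of `v` inside `S`. -/
def HasNeighbors (H : SimpleGraph V) (S : Set V) (v x y : V) : Prop :=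
  x ∈ S ∧ y ∈ S ∧ x ≠ y ∧ ∀ w ∈ S, H.Adj v w ↔ w = x ∨ w = y

/-- All vertices of `S` except for the distinct vertices `a` and `b` have degree two. -/
def TwoBranch (H : SimpleGraph V) (S : Set V) (a b : V) : Prop :=
  a ∈ S ∧ b ∈ S ∧ a ≠ b ∧ ∀ v ∈ S, v ≠ a → v ≠ b → ∃ x y, HasNeighbors H S v x y

theorem HasNeighbors.swap {v : V} (h : HasNeighbors H S v x y) : HasNeighbors H S v y x :=
  ⟨h.2.1, h.1, h.2.2.1.symm, fun w hw => (h.2.2.2 w hw).trans or_comm⟩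

theorem HasNeighbors.left {v : V} (h : HasNeighbors H S v x y) : H.Adj v x :=
  (h.2.2.2 x h.1).2 (Or.inl rfl)

theorem HasNeighbors.right {v : V} (h : HasNeighbors H S v x y) : H.Adj v y :=
  h.swap.left

theorem TwoBranch.swap {a b : V} (h : TwoBranch H S a b) : TwoBranch H S b a :=
  ⟨h.2.1, h.1, h.2.2.1.symm, fun v hv hb ha => h.2.2.2 v hv ha hb⟩

theorem NoCliqueSep.linked (h : NoCliqueSep H S) (hS : S.Nonempty) : Linked H S := by
  simpa using h ∅ (Set.empty_subset _) (by simp) hS.ne_empty.symm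

theorem NoCliqueSep.linked_sdiff_singleton (h : NoCliqueSep H S) (v : V) {w : V} (hw : w ∈ S)
    (hwv : w ≠ v) : Linked H (S \ {v}) := by
  by_cases hv : v ∈ S
  · exact h {v} (by simpa) (by simp) fun he => hwv (he ▸ hw : w ∈ ({v} : Set V))
  · rw [Set.sdiff_singleton_eq_self hv]
    exact h.linked ⟨w, hw⟩

/-- There is no cut vertex: a proper non-empty subset of the complement of a vertex `v` is left by
some edge that avoids `v`. -/
theorem NoCliqueSep.false_of_closedIn (h : NoCliqueSep H S) {v w : V} (hw : w ∈ S)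
    (hwv : w ≠ v) (hTS : T ⊆ S) (hvT : v ∉ T) (hT : T.Nonempty) (hcl : ClosedIn H (S \ {v}) T)
    (hwT : w ∉ T) : False :=
  hwT ((h.linked_sdiff_singleton v hw hwv).2 T (fun _ ht => ⟨hTS ht, fun h => hvT (h ▸ ht)⟩)
    hT hcl ⟨hw, hwv⟩)

/-- In a graph without clique separator that is not of degree two outside two vertices, the
vertices of degree at most two have exactly two neighbours, which are not adjacent. -/
theorem NoCliqueSep.neighbors_of_degree_le_two (h : NoCliqueSep H S) (hne : S.Nontrivial)
    (h2 : ∀ a b, ¬ TwoBranch H S a b) {z p q : V} (hz : z ∈ S)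
    (hpq : ∀ w ∈ S, H.Adj z w → w = p ∨ w = q) : HasNeighbors H S z p q ∧ ¬ H.Adj p q := by
  have hmain : ¬ H.IsClique {w | w ∈ S ∧ H.Adj z w} := by
    intro hcl
    by_cases hall : ∃ r ∈ S, r ≠ z ∧ ¬ H.Adj z r
    · obtain ⟨r, hr, hrz, hzr⟩ := hall
      have := (h {w | w ∈ S ∧ H.Adj z w} (fun w hw => hw.1) hcl
        (fun he => H.loopless.irrefl z (he.symm ▸ hz : z ∈ {w | w ∈ S ∧ H.Adj z w}).2)).2 {z}
        (by simp [hz]) ⟨z, rfl⟩ (by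
          rintro a rfl b hb hab
          exact absurd ⟨hb.1, hab⟩ hb.2)
      exact hrz (this ⟨hr, fun h => hzr h.2⟩)
    · push Not at hall
      -- here the whole graph consists of `z` and its neighbours
      obtain ⟨s, hs, hsz⟩ := hne.exists_ne z
      by_cases h3 : ∃ t ∈ S, t ≠ z ∧ t ≠ s
      · obtain ⟨t, ht, htz, hts⟩ := h3
        refine h2 s t ⟨hs, ht, hts.symm, fun v hv hvs hvt => ⟨s, t, hs, ht, hts.symm, ?_⟩⟩
        have hcase : ∀ w ∈ S, w = z ∨ w = s ∨ w = t := by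
          intro w hw
          by_contra! hw'
          have e1 := hpq w hw (hall w hw hw'.1)
          have e2 := hpq s hs (hall s hs hsz)
          have e3 := hpq t ht (hall t ht htz)
          grind
        have hvz : v = z := by grind
        subst hvz
        intro w hw
        constructor
        · intro hvw
          have := hvw.ne
          grind
        · rintro (rfl | rfl)
          · exact hall _ hs hsz
          · exact hall _ ht htz
      · push Not at h3
        exact h2 z s ⟨hz, hs, hsz.symm, fun v hv hvz hvs => absurd (h3 v hv hvz) hvs⟩
  rw [SimpleGraph.isClique_iff, Set.Pairwise] at hmain
  push Not at hmain
  obtain ⟨u, ⟨huS, hzu⟩, v, ⟨hvS, hzv⟩, huv, hnadj⟩ := hmain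
  have hz2 : ∀ w ∈ S, H.Adj z w ↔ w = u ∨ w = v := by
    intro w hw
    constructor
    · intro hzw
      have e1 := hpq u huS hzu
      have e2 := hpq v hvS hzv
      have e3 := hpq w hw hzw
      grind
    · rintro (rfl | rfl)
      · exact hzu
      · exact hzv
  rcases hpq u huS hzu with rfl | rfl
  · obtain rfl : v = q := (hpq v hvS hzv).resolve_left huv.symm
    exact ⟨⟨huS, hvS, huv, hz2⟩, hnadj⟩
  · obtain rfl : v = p := (hpq v hvS hzv).resolve_right huv.symm
    exact ⟨HasNeighbors.swap ⟨huS, hvS, huv, hz2⟩, fun h => hnadj h.symm⟩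

theorem adj_of_merge_adj_of_hasNeighbors (hnb : HasNeighbors H S z c d) {u v : V} (hu : u ∈ S)
    (hv : v ∈ S) (h : (merge H c z).Adj u v) : H.Adj u v ∨ (u = c ∧ v = d) ∨ (u = d ∧ v = c) := by
  rcases h with h | ⟨rfl, hvu, h⟩ | ⟨rfl, huv, h⟩
  · exact Or.inl h
  · exact Or.inr (Or.inl ⟨rfl, ((hnb.2.2.2 v hv).1 h).resolve_left hvu⟩)
  · exact Or.inr (Or.inr ⟨((hnb.2.2.2 u hu).1 h).resolve_left huv, rfl⟩)

/-- Let `c` and `d` be the neighbours of the vertex `z` of degree two. If `e` is adjacent to `c` and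
`d`, and a connected set `W` touches `c`, `d` and `e`, then `{c, z}`, `{d}`, `{e}`, `W` form a
`K_4`-minor. -/
theorem hasHalfEmbedding_of_suppressed (hz : z ∈ S) (hnb : HasNeighbors H S z c d) {e : V}
    {W : Set V} (he : e ∈ S) (hWS : W ⊆ S) (hW : Linked H W) (hec : H.Adj e c) (hed : H.Adj e d)
    (hcW : c ∉ W) (hdW : d ∉ W) (heW : e ∉ W) (hzW : z ∉ W)
    (tc : Touch H {c} W) (td : Touch H {d} W) (te : Touch H {e} W) : HasHalfEmbedding H S := by
  have hez : e ≠ z := by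
    rintro rfl
    exact hzW (by
      rcases te with ⟨x, rfl, hx⟩ | ⟨x, rfl, w, hw, hxw⟩
      · exact hx
      · rcases (hnb.2.2.2 w (hWS hw)).1 hxw with rfl | rfl
        · exact absurd hw hcW
        · exact absurd hw hdW)
  refine ⟨{d}, {e}, {c} ∪ {z}, W, ⟨by simpa using hnb.2.1, by simpa,
    by simp [Set.insert_subset_iff, hnb.1, hz], hWS⟩, ⟨linked_singleton _, linked_singleton _,
    (linked_singleton _).union (linked_singleton _) (.of_adj rfl rfl hnb.left.symm), hW⟩,
    ⟨by simpa using hed.ne', by simp [hnb.2.2.1.symm, hnb.right.ne'], by simpa,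
      by simp [hec.ne, hez], by simpa⟩,
    ⟨.of_adj rfl rfl hed.symm, .of_adj rfl (Or.inr rfl) hnb.right.symm, td,
      .of_adj rfl (Or.inl rfl) hec, te, ?_⟩, ?_⟩
  · rcases tc with ⟨x, rfl, hx⟩ | ⟨x, rfl, w, hw, hxw⟩
    · exact absurd hx hcW
    · exact .of_adj (Or.inl rfl) hw hxw
  · rintro m ⟨rfl | rfl, hm⟩
    · exact absurd hm hcW
    · exact absurd hm hzW

/-- Suppressing a vertex `z` of degree two, that is, contracting the edge `cz`, does not create a
clique separator, unless the two neighbours of `z` already separate the rest of the graph or there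
is a `K_4`-minor. -/
theorem NoCliqueSep.merge (h : NoCliqueSep H S) (hz : z ∈ S) (hnb : HasNeighbors H S z c d)
    (hlink : Linked H (S \ {c, d, z})) (hno : ¬ HasHalfEmbedding H S) :
    NoCliqueSep (CliqueEmb.merge H c z) (S \ {z}) := by
  intro K hKS hK hKne
  have hle : ∀ {R : Set V}, Linked H R → Linked (CliqueEmb.merge H c z) R :=
    fun hR => hR.congr fun _ _ _ _ hab => Or.inl hab
  have hzK : z ∉ K := fun hzK => (hKS hzK).2 rfl
  have hcz : H.Adj c z := hnb.left.symm
  by_cases hcd : c ∈ K ∧ d ∈ K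
  · obtain ⟨hcK, hdK⟩ := hcd
    have hadjc : ∀ e ∈ K, e ≠ c → e ≠ d → H.Adj e c ∧ H.Adj e d := by
      intro e he hec hed
      have h1 := adj_of_merge_adj_of_hasNeighbors hnb (hKS he).1 hnb.1 (hK he hcK hec)
      have h2 := adj_of_merge_adj_of_hasNeighbors hnb (hKS he).1 hnb.2.1 (hK he hdK hed)
      exact ⟨h1.resolve_right (by grind), h2.resolve_right (by grind)⟩
    by_cases he : ∃ e ∈ K, e ≠ c ∧ e ≠ d
    · obtain ⟨e, heK, hec, hed⟩ := he
      obtain ⟨hec', hed'⟩ := hadjc e heK hec hed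
      have heS := (hKS heK).1
      by_cases hf : ∃ f ∈ K, f ≠ c ∧ f ≠ d ∧ f ≠ e
      · obtain ⟨f, hfK, hfc, hfd, hfe⟩ := hf
        obtain ⟨hfc', hfd'⟩ := hadjc f hfK hfc hfd
        have hef : H.Adj e f :=
          (adj_of_merge_adj_of_hasNeighbors hnb heS (hKS hfK).1
            (hK heK hfK hfe.symm)).resolve_right (by grind)
        refine absurd (hasHalfEmbedding_of_suppressed hz hnb (W := {f}) heS
          (by simpa using (hKS hfK).1) (linked_singleton _) hec' hed' (by simpa using hfc.symm)
          (by simpa using hfd.symm) (by simpa using hfe.symm) (fun hzf => hzK (hzf ▸ hfK))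
          (.of_adj rfl rfl hfc'.symm) (.of_adj rfl rfl hfd'.symm) (.of_adj rfl rfl hef)) hno
      · push Not at hf
        by_contra hcon
        obtain ⟨r, hr⟩ : ((S \ {z}) \ K).Nonempty := by
          rw [Set.sdiff_nonempty]
          exact fun hsub => hKne (hKS.antisymm hsub)
        obtain ⟨T, hT, ⟨t, ht⟩, hTc, v, hv, hvT⟩ := not_linked ⟨r, hr⟩ hcon
        obtain ⟨W, hWT, htW, hW, hWc⟩ := exists_component H ht
        have hWS : W ⊆ S := fun w hw => (hT (hWT hw)).1.1
        have hWz : z ∉ W := fun hw => (hT (hWT hw)).1.2 rfl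
        have hWK : ∀ k ∈ K, k ∉ W := fun k hk hw => (hT (hWT hw)).2 hk
        have hWz' : ∀ w ∈ W, ¬ H.Adj w z := fun w hw hwz => by
          rcases (hnb.2.2.2 w (hWS hw)).1 hwz.symm with rfl | rfl
          · exact hWK _ hcK hw
          · exact hWK _ hdK hw
        -- `W` can only be left through `c`, `d` and `e`
        have hout : ∀ w ∈ W, ∀ u ∈ S, H.Adj w u → u ∈ W ∨ u = c ∨ u = d ∨ u = e := by
          intro w hw u hu hwu
          by_cases huz : u = z
          · exact absurd (huz ▸ hwu) (hWz' w hw)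
          · by_cases huK : u ∈ K
            · have := hf u huK
              tauto
            · exact Or.inl (hWc w hw u (hTc w (hWT hw) u ⟨⟨hu, huz⟩, huK⟩ (Or.inl hwu)) hwu)
        have te : Touch H {e} W := by
          by_contra hte
          refine hWK e heK (hlink.2 W (fun w hw => ⟨hWS hw, ?_⟩) ⟨t, htW⟩ ?_
            ⟨heS, by
              have : e ≠ z := fun he => hzK (he ▸ heK)
              simp [hec, hed, this]⟩)
          · rintro (rfl | rfl | rfl)
            · exact hWK _ hcK hw
            · exact hWK _ hdK hw
            · exact hWz hw
          · intro w hw u hu hwu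
            rcases hout w hw u hu.1 hwu with h1 | rfl | rfl | rfl
            · exact h1
            · exact absurd hu.2 (by simp)
            · exact absurd hu.2 (by simp)
            · exact absurd (Touch.of_adj (Set.mem_singleton _) hw hwu.symm) hte
        -- otherwise `e` and the other neighbour of `z` form a clique separator
        have tcd : ∀ x y : V, x ∈ K → y ∈ K → x ∈ S → y ∈ S → x ≠ y → x ≠ e → H.Adj e y →
            (∀ u, u = c ∨ u = d ∨ u = e → u = x ∨ u = y ∨ u = e) → Touch H {x} W := by
          intro x y hxK hyK hx hy hxy hxe hey hxy'
          by_contra htx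
          have hlk := h {e, y} (by simp [Set.insert_subset_iff, heS, hy])
            (by simpa using fun _ => hey) (fun heq => by
              have : x ∈ ({e, y} : Set V) := heq ▸ hx
              grind)
          refine hWK x hxK (hlk.2 W (fun w hw => ⟨hWS hw, ?_⟩) ⟨t, htW⟩ ?_
            ⟨hx, by simp [hxe, hxy]⟩)
          · rintro (rfl | rfl)
            · exact hWK _ heK hw
            · exact hWK _ hyK hw
          · intro w hw u hu hwu
            rcases hout w hw u hu.1 hwu with h1 | h1
            · exact h1
            · rcases hxy' u h1 with rfl | rfl | rfl
              · exact absurd (Touch.of_adj (Set.mem_singleton _) hw hwu.symm) htx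
              · exact absurd hu.2 (by simp)
              · exact absurd hu.2 (by simp)
        exact hno (hasHalfEmbedding_of_suppressed hz hnb heS hWS hW hec' hed' (hWK c hcK)
          (hWK d hdK) (hWK e heK) hWz
          (tcd c d hcK hdK hnb.1 hnb.2.1 hnb.2.2.1 hec.symm hed' (by tauto))
          (tcd d c hdK hcK hnb.2.1 hnb.1 hnb.2.2.1.symm hed.symm hec' (by tauto)) te)
    · push Not at he
      have : (S \ {z}) \ K = S \ {c, d, z} := by
        ext v
        simp only [Set.mem_sdiff, Set.mem_insert_iff, Set.mem_singleton_iff]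
        constructor
        · rintro ⟨⟨h1, h2⟩, h3⟩
          exact ⟨h1, by rintro (rfl | rfl | rfl) <;> tauto⟩
        · rintro ⟨h1, h2⟩
          exact ⟨⟨h1, by tauto⟩, fun hv => h2 (by have := he v hv; tauto)⟩
      rw [this]
      exact hle hlink
  · have hKH : H.IsClique K := by
      intro u hu v hv huv
      rcases adj_of_merge_adj_of_hasNeighbors hnb (hKS hu).1 (hKS hv).1 (hK hu hv huv) with
        h1 | ⟨rfl, rfl⟩ | ⟨rfl, rfl⟩
      · exact h1
      · exact absurd ⟨hu, hv⟩ hcd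
      · exact absurd ⟨hv, hu⟩ hcd
    have hlk := h K (fun k hk => (hKS hk).1) hKH (fun heq => hzK (heq ▸ hz))
    have hset : (S \ {z}) \ K = (S \ K) \ {z} := by
      ext; simp only [Set.mem_sdiff]; tauto
    rw [hset]
    by_cases hcK : c ∈ K
    · have hdK : d ∉ K := fun hdK => hcd ⟨hcK, hdK⟩
      refine hle (hlk.remove_leaf ⟨hnb.2.1, hdK⟩ hnb.right.ne' fun w hw hzw => ?_)
      exact ((hnb.2.2.2 w hw.1).1 hzw).resolve_left fun hwc => hw.2 (hwc ▸ hcK)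
    · exact hlk.contract ⟨hnb.1, hcK⟩ hcz

/-- Undoing the suppression of `z` keeps the degrees of all other vertices. -/
theorem TwoBranch.of_merge (hz : z ∈ S) (hnb : HasNeighbors H S z c d) (hcd : ¬ H.Adj c d)
    (h : TwoBranch (CliqueEmb.merge H c z) (S \ {z}) a b) : TwoBranch H S a b := by
  refine ⟨h.1.1, h.2.1.1, h.2.2.1, fun v hv hva hvb => ?_⟩
  by_cases hvz : v = z
  · exact ⟨c, d, hvz ▸ hnb⟩
  obtain ⟨p, q, hpq⟩ := h.2.2.2 v ⟨hv, hvz⟩ hva hvb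
  have hcz := hnb.left.ne'
  have hdz := hnb.right.ne'
  -- at `c` and `d` the new edge between them stands for the edge to `z`
  have key : ∀ x y : V, (x = c ∧ y = d ∨ x = d ∧ y = c) →
      ∀ q, HasNeighbors (CliqueEmb.merge H c z) (S \ {z}) x y q → HasNeighbors H S x z q := by
    intro x y hxy q hq
    have hxz : H.Adj x z := by
      rcases hxy with ⟨rfl, -⟩ | ⟨rfl, -⟩
      · exact hnb.left.symm
      · exact hnb.right.symm
    have hxy' : ¬ H.Adj x y := by
      rcases hxy with ⟨rfl, rfl⟩ | ⟨rfl, rfl⟩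
      · exact hcd
      · exact fun h => hcd h.symm
    have hxS : x ∈ S := by
      rcases hxy with ⟨rfl, -⟩ | ⟨rfl, -⟩
      · exact hnb.1
      · exact hnb.2.1
    refine ⟨hz, hq.2.1.1, fun he => hq.2.1.2 he.symm, fun w hw => ?_⟩
    by_cases hwz : w = z
    · simp [hwz, hxz]
    · have h1 := hq.2.2.2 w ⟨hw, hwz⟩
      constructor
      · intro hxw
        rcases h1.1 (Or.inl hxw) with rfl | rfl
        · exact absurd hxw hxy'
        · exact Or.inr rfl
      · rintro (rfl | rfl)
        · exact hxz
        · rcases adj_of_merge_adj_of_hasNeighbors hnb hxS hw (h1.2 (Or.inr rfl)) with h2 | h2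
          · exact h2
          · have := hq.2.2.1
            grind
  by_cases hvcd : v = c ∨ v = d
  · obtain ⟨y, hvy, hy, hadj⟩ : ∃ y, (v = c ∧ y = d ∨ v = d ∧ y = c) ∧ y ∈ S \ {z} ∧
        (CliqueEmb.merge H c z).Adj v y := by
      have hcd' := hnb.2.2.1
      rcases hvcd with rfl | rfl
      · exact ⟨d, Or.inl ⟨rfl, rfl⟩, ⟨hnb.2.1, hdz⟩, Or.inr (Or.inl ⟨rfl, hcd'.symm, hnb.right⟩)⟩
      · exact ⟨c, Or.inr ⟨rfl, rfl⟩, ⟨hnb.1, hcz⟩, Or.inr (Or.inr ⟨rfl, hcd'.symm, hnb.right⟩)⟩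
    rcases (hpq.2.2.2 y hy).1 hadj with rfl | rfl
    · exact ⟨z, q, key v y hvy q hpq⟩
    · exact ⟨z, p, key v y hvy p hpq.swap⟩
  · push Not at hvcd
    refine ⟨p, q, hpq.1.1, hpq.2.1.1, hpq.2.2.1, fun w hw => ?_⟩
    have hvz' : ¬ H.Adj v z := fun hvz' => by
      have := (hnb.2.2.2 v hv).1 hvz'.symm
      tauto
    by_cases hwz : w = z
    · subst hwz
      have h1 := hpq.1.2
      have h2 := hpq.2.1.2
      simp only [Set.mem_singleton_iff] at h1 h2
      grind
    · rw [← hpq.2.2.2 w ⟨hw, hwz⟩]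
      refine ⟨Or.inl, fun hvw => ?_⟩
      exact (adj_of_merge_adj_of_hasNeighbors hnb hv hw hvw).resolve_right (by tauto)

/-! ### Lobes of a separating pair -/

/-- `X` is a component of the complement of the non-adjacent pair `c`, `d`, attached to both;
the vertex `z` outside of `X` has exactly the neighbours `c` and `d`. -/
structure Lobe (H : SimpleGraph V) (S : Set V) (z c d : V) (X : Set V) : Prop where
  z_mem : z ∈ S
  nb : HasNeighbors H S z c d
  not_adj : ¬ H.Adj c d
  subset : X ⊆ S
  c_notMem : c ∉ X
  d_notMem : d ∉ X
  z_notMem : z ∉ X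
  linked : Linked H X
  closed : ClosedIn H (S \ {c, d}) X
  c_adj : ∃ w ∈ X, H.Adj c w
  d_adj : ∃ w ∈ X, H.Adj d w

theorem Lobe.swap (h : Lobe H S z c d X) : Lobe H S z d c X where
  z_mem := h.z_mem
  nb := h.nb.swap
  not_adj := fun h' => h.not_adj h'.symm
  subset := h.subset
  c_notMem := h.d_notMem
  d_notMem := h.c_notMem
  z_notMem := h.z_notMem
  linked := h.linked
  closed := by simpa [Set.pair_comm] using h.closed
  c_adj := h.d_adj
  d_adj := h.c_adj

theorem Lobe.adj_mem (h : Lobe H S z c d X) {u v : V} (hu : u ∈ X) (hv : v ∈ S)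
    (huv : H.Adj u v) : v ∈ X ∨ v = c ∨ v = d := by
  by_cases hcd : v = c ∨ v = d
  · exact Or.inr hcd
  · exact Or.inl (h.closed u hu v ⟨hv, by simpa using hcd⟩ huv)

theorem Lobe.hasNeighbors (h : Lobe H S z c d X) {v x y : V} (hv : v ∈ X)
    (hn : HasNeighbors H (X ∪ {c, d, z}) v x y) : HasNeighbors H S v x y := by
  have hsub : X ∪ {c, d, z} ⊆ S := Set.union_subset h.subset
    (by simp [Set.insert_subset_iff, h.nb.1, h.nb.2.1, h.z_mem])
  refine ⟨hsub hn.1, hsub hn.2.1, hn.2.2.1, fun w hw => ?_⟩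
  constructor
  · intro hvw
    refine (hn.2.2.2 w ?_).1 hvw
    rcases h.adj_mem hv hw hvw with h1 | rfl | rfl
    · exact Or.inl h1
    · simp
    · simp
  · rintro (rfl | rfl)
    · exact hn.left
    · exact hn.right

theorem Lobe.of_component (h : NoCliqueSep H S) (hz : z ∈ S) (hnb : HasNeighbors H S z c d)
    (hcd : ¬ H.Adj c d) (hX : X ⊆ S \ {c, d}) (hzX : z ∉ X) (hlink : Linked H X)
    (hcl : ClosedIn H (S \ {c, d}) X) : Lobe H S z c d X := by
  have hcX : c ∉ X := fun hc => (hX hc).2 (by simp)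
  have hdX : d ∉ X := fun hc => (hX hc).2 (by simp)
  refine ⟨hz, hnb, hcd, fun v hv => (hX hv).1, hcX, hdX, hzX, hlink, hcl, ?_, ?_⟩
  · by_contra! hno
    refine h.false_of_closedIn hnb.1 hnb.2.2.1 (fun v hv => (hX hv).1) hdX hlink.1 ?_ hcX
    intro u hu v hv huv
    refine hcl u hu v ⟨hv.1, ?_⟩ huv
    rintro (rfl | rfl)
    · exact hno u hu huv.symm
    · exact hv.2 rfl
  · by_contra! hno
    refine h.false_of_closedIn hnb.2.1 hnb.2.2.1.symm (fun v hv => (hX hv).1) hcX hlink.1 ?_ hdX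
    intro u hu v hv huv
    refine hcl u hu v ⟨hv.1, ?_⟩ huv
    rintro (rfl | rfl)
    · exact hv.2 rfl
    · exact hno u hu huv.symm

/-- A single lobe together with the path `c`, `z`, `d` has no clique separator. -/
theorem Lobe.noCliqueSep (h : Lobe H S z c d X) (hS : NoCliqueSep H S) :
    NoCliqueSep H (X ∪ {c, d, z}) := by
  intro K hK hcl hne
  have hsub : X ∪ {c, d, z} ⊆ S := Set.union_subset h.subset
    (by simp [Set.insert_subset_iff, h.nb.1, h.nb.2.1, h.z_mem])
  have hcz := h.nb.left
  have hdz := h.nb.right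
  have hcd : ¬ (c ∈ K ∧ d ∈ K) := fun hh => h.not_adj (hcl hh.1 hh.2 h.nb.2.2.1)
  refine ⟨by
    rw [Set.sdiff_nonempty]
    exact fun hs => hne (hK.antisymm hs), fun T hT hTn hTc => ?_⟩
  by_cases hzK : z ∈ K
  · have hXK : ∀ v ∈ X, v ∉ K := fun v hv hvK => by
      have hzv : z ≠ v := fun he => h.z_notMem (he ▸ hv)
      rcases (h.nb.2.2.2 v (h.subset hv)).1 (hcl hzK hvK hzv) with rfl | rfl
      · exact h.c_notMem hv
      · exact h.d_notMem hv
    have hTX : (T ∩ X).Nonempty := by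
      obtain ⟨t, ht⟩ := hTn
      rcases (hT ht).1 with h1 | rfl | rfl | rfl
      · exact ⟨t, ht, h1⟩
      · obtain ⟨w, hw, hcw⟩ := h.c_adj
        exact ⟨w, hTc _ ht w ⟨Or.inl hw, hXK w hw⟩ hcw, hw⟩
      · obtain ⟨w, hw, hcw⟩ := h.d_adj
        exact ⟨w, hTc _ ht w ⟨Or.inl hw, hXK w hw⟩ hcw, hw⟩
      · exact absurd hzK (hT ht).2
    have hXT : X ⊆ T := fun v hv => (h.linked.2 (T ∩ X) Set.inter_subset_right hTX
      (fun u hu v hv huv => ⟨hTc u hu.1 v ⟨Or.inl hv, hXK v hv⟩ huv, hv⟩) hv).1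
    rintro v ⟨hv | rfl | rfl | rfl, hvK⟩
    · exact hXT hv
    · obtain ⟨w, hw, hcw⟩ := h.c_adj
      exact hTc w (hXT hw) _ ⟨by simp, hvK⟩ hcw.symm
    · obtain ⟨w, hw, hcw⟩ := h.d_adj
      exact hTc w (hXT hw) _ ⟨by simp, hvK⟩ hcw.symm
    · exact absurd hzK hvK
  · -- everything outside the lobe is attached like `z`, so it joins `T` exactly if `z` does
    have := (hS K (hK.trans hsub) hcl (fun he => hzK (he ▸ h.z_mem))).2
      (T ∪ {v | v ∈ S ∧ v ∉ X ∪ {c, d, z} ∧ z ∈ T}) (by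
        rintro v (hv | hv)
        · exact ⟨hsub (hT hv).1, (hT hv).2⟩
        · exact ⟨hv.1, fun hvK => hv.2.1 (hK hvK)⟩) (hTn.mono Set.subset_union_left) (by
        rintro u (hu | ⟨huS, hu, hzT⟩) v hv huv
        · by_cases hvX : v ∈ X ∪ {c, d, z}
          · exact Or.inl (hTc u hu v ⟨hvX, hv.2⟩ huv)
          · refine Or.inr ⟨hv.1, hvX, ?_⟩
            rcases (hT hu).1 with h1 | rfl | rfl | rfl
            · have := h.adj_mem h1 hv.1 huv
              exact absurd (by simp; tauto) hvX
            · exact hTc _ hu z ⟨by simp, hzK⟩ hcz.symm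
            · exact hTc _ hu z ⟨by simp, hzK⟩ hdz.symm
            · exact hu
        · by_cases hvX : v ∈ X ∪ {c, d, z}
          · left
            rcases hvX with h1 | rfl | rfl | rfl
            · have := h.adj_mem h1 huS huv.symm
              exact absurd (by simp; tauto) hu
            · exact hTc z hzT _ ⟨by simp, hv.2⟩ hcz
            · exact hTc z hzT _ ⟨by simp, hv.2⟩ hdz
            · exact hzT
          · exact Or.inr ⟨hv.1, hvX, hzT⟩)
    exact fun v hv => (this ⟨hsub hv.1, hv.2⟩).resolve_right fun hh => hh.2.1 hv.1

/-- The two neighbours of every vertex of degree two are not adjacent and separate the remaining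
vertices; so suppressing such a vertex, which makes its neighbours adjacent, creates a clique
separator. -/
def Unsuppressible (H : SimpleGraph V) (S : Set V) : Prop :=
  ∀ v ∈ S, ∀ e f, HasNeighbors H S v e f → ¬ H.Adj e f ∧ ¬ Linked H (S \ {e, f, v})

/-- In an unsuppressible graph the neighbours of a vertex of degree two have larger degree. -/
theorem Unsuppressible.not_hasNeighbors (hs : Unsuppressible H S) (h : NoCliqueSep H S)
    {v e f : V} (hv : v ∈ S) (hn : HasNeighbors H S v e f) :
    ∀ x y, ¬ HasNeighbors H S e x y := by
  have main : ∀ g, ¬ HasNeighbors H S e v g := by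
    intro g hg
    obtain ⟨hef, hlk⟩ := hs v hv e f hn
    have hgR : g ∈ S \ {e, f, v} := by
      refine ⟨hg.2.1, ?_⟩
      rintro (rfl | rfl | rfl)
      · exact H.loopless.irrefl _ hg.right
      · exact hef hg.right
      · exact hg.2.2.1 rfl
    have key : ∀ T ⊆ S \ {e, f, v}, T.Nonempty → ClosedIn H (S \ {e, f, v}) T → g ∈ T := by
      intro T hT hTn hTc
      by_contra hgT
      refine h.false_of_closedIn (v := f) (w := e) hn.1 hn.2.2.1 (fun t ht => (hT ht).1)
        (fun hf => (hT hf).2 (by simp)) hTn ?_ (fun he => (hT he).2 (by simp))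
      intro u hu w hw huw
      refine hTc u hu w ⟨hw.1, ?_⟩ huw
      have hu' := hT hu
      simp only [Set.mem_sdiff, Set.mem_insert_iff, Set.mem_singleton_iff] at hu' hw
      rintro (rfl | rfl | rfl)
      · have := (hg.2.2.2 u hu'.1).1 huw.symm
        grind
      · exact hw.2 rfl
      · have := (hn.2.2.2 u hu'.1).1 huw.symm
        grind
    obtain ⟨T, hT, hTn, hTc, w, hw, hwT⟩ := not_linked ⟨g, hgR⟩ hlk
    exact (key _ Set.sdiff_subset ⟨w, hw, hwT⟩ hTc.compl).2 (key T hT hTn hTc)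
  intro x y hxy
  rcases (hxy.2.2.2 v hv).1 hn.left.symm with rfl | rfl
  · exact main y hxy
  · exact main x hxy.swap

/-- If the lobe `X` has a vertex of larger degree, then an attachment vertex `d` of degree two
in the graph of the lobe is attached to one of the two branch vertices of that graph. -/
theorem Lobe.exists_unique_adj (h : Lobe H S z c d X) (hS : NoCliqueSep H S)
    (hs : Unsuppressible H S) (h2 : TwoBranch H (X ∪ {c, d, z}) a b) {v₀ : V} (hv₀ : v₀ ∈ X)
    (hv₀' : ∀ x y, ¬ HasNeighbors H S v₀ x y) (hda : d ≠ a) (hdb : d ≠ b) :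
    ∃ d' ∈ X, (d' = a ∨ d' = b) ∧ ∀ w ∈ X, H.Adj d w ↔ w = d' := by
  have hsub : X ∪ {c, d, z} ⊆ S := Set.union_subset h.subset
    (by simp [Set.insert_subset_iff, h.nb.1, h.nb.2.1, h.z_mem])
  obtain ⟨d', hd'⟩ : ∃ d', HasNeighbors H (X ∪ {c, d, z}) d z d' := by
    obtain ⟨p, q, hpq⟩ := h2.2.2.2 d (by simp) hda hdb
    rcases (hpq.2.2.2 z (by simp)).1 h.nb.right.symm with rfl | rfl
    · exact ⟨q, hpq⟩
    · exact ⟨p, hpq.swap⟩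
  have hd'X : d' ∈ X := by
    rcases hd'.2.1 with h1 | rfl | rfl | rfl
    · exact h1
    · exact absurd hd'.right.symm h.not_adj
    · exact absurd hd'.right (H.loopless.irrefl _)
    · exact absurd rfl hd'.2.2.1
  have hdX : ∀ w ∈ X, H.Adj d w ↔ w = d' := fun w hw => by
    rw [hd'.2.2.2 w (Or.inl hw)]
    exact or_iff_right fun hwz => h.z_notMem (hwz ▸ hw)
  refine ⟨d', hd'X, ?_, hdX⟩
  by_contra! hab
  obtain ⟨e, he⟩ : ∃ e, HasNeighbors H S d' d e := by
    obtain ⟨p, q, hpq⟩ := h2.2.2.2 d' (Or.inl hd'X) hab.1 hab.2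
    rcases (hpq.2.2.2 d (by simp)).1 hd'.right.symm with rfl | rfl
    · exact ⟨q, h.hasNeighbors hd'X hpq⟩
    · exact ⟨p, h.hasNeighbors hd'X hpq.swap⟩
  have hed : e ≠ d := he.2.2.1.symm
  rcases h.adj_mem hd'X he.2.1 he.right with heX | rfl | rfl
  · -- every component of the complement of `d`, `e`, `d'` contains `c`
    have hcd := h.nb.2.2.1
    have hce : c ≠ e := fun he => h.c_notMem (he ▸ heX)
    have hcd' : c ≠ d' := fun he => h.c_notMem (he ▸ hd'X)
    have hcR : c ∈ S \ {d, e, d'} := ⟨h.nb.1, by simp [hcd, hce, hcd']⟩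
    have key : ∀ T ⊆ S \ {d, e, d'}, T.Nonempty → ClosedIn H (S \ {d, e, d'}) T → c ∈ T := by
      intro T hT hTn hTc
      by_contra hcT
      have hTd : d ∉ T := fun hd => (hT hd).2 (by simp)
      by_cases hTX : T ⊆ X
      · refine hS.false_of_closedIn (v := e) (w := d) h.nb.2.1 hed.symm (fun t ht => (hT ht).1)
          (fun hf => (hT hf).2 (by simp)) hTn ?_ hTd
        intro u hu w hw huw
        refine hTc u hu w ⟨hw.1, ?_⟩ huw
        have hu' := hT hu
        simp only [Set.mem_sdiff, Set.mem_insert_iff, Set.mem_singleton_iff] at hu' hw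
        rintro (rfl | rfl | rfl)
        · have := (hdX u (hTX hu)).1 huw.symm
          grind
        · exact hw.2 rfl
        · have := (he.2.2.2 u hu'.1).1 huw.symm
          grind
      · obtain ⟨t, ht, htX⟩ := Set.not_subset.1 hTX
        refine hS.false_of_closedIn (T := T \ X) (v := d) (w := c) h.nb.1 hcd
          (fun t ht => (hT ht.1).1) (fun hf => hTd hf.1) ⟨t, ht, htX⟩ ?_ (fun hc => hcT hc.1)
        intro u hu w hw huw
        have hwX : w ∉ X := fun hwX => by
          rcases h.adj_mem hwX (hT hu.1).1 huw.symm with h1 | rfl | rfl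
          · exact hu.2 h1
          · exact hcT hu.1
          · exact hTd hu.1
        refine ⟨hTc u hu.1 w ⟨hw.1, ?_⟩ huw, hwX⟩
        rintro (rfl | rfl | rfl)
        · exact hw.2 rfl
        · exact hwX heX
        · exact hwX hd'X
    obtain ⟨T, hT, hTn, hTc, w, hw, hwT⟩ :=
      not_linked ⟨c, hcR⟩ (hs d' (h.subset hd'X) d e he).2
    exact (key _ Set.sdiff_subset ⟨w, hw, hwT⟩ hTc.compl).2 (key T hT hTn hTc)
  · -- `d'` is a whole component
    have := h.linked.2 {d'} (by simpa) ⟨d', rfl⟩ (by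
      rintro u rfl w hw huw
      rcases (he.2.2.2 w (h.subset hw)).1 huw with rfl | rfl
      · exact absurd hw h.d_notMem
      · exact absurd hw h.c_notMem) hv₀
    obtain rfl : v₀ = d' := this
    exact hv₀' _ _ he
  · exact hed rfl

/-- Two lobes of `c`, `d`, one of them having a vertex of larger degree, yield a half embedding
if `d` has the branch vertex `a` as its only neighbour in `X`. The sets are `{a}`, `{d}` and two
sets that run from `a` to `d` and intersect in `{b, c}`, where `b = c` is possible. -/
theorem Lobe.hasHalfEmbedding (h : Lobe H S z c d X) (hY : Lobe H S z c d Y)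
    (hXY : Disjoint X Y) (hS : NoCliqueSep H S) (hs : Unsuppressible H S)
    (h2 : TwoBranch H (X ∪ {c, d, z}) a b) {v₀ : V} (hv₀ : v₀ ∈ X)
    (hv₀' : ∀ x y, ¬ HasNeighbors H S v₀ x y) (hdb : d ≠ b) (haX : a ∈ X)
    (hda : ∀ w ∈ X, H.Adj d w ↔ w = a) : HasHalfEmbedding H S := by
  have hcd := h.nb.2.2.1
  have hca : c ≠ a := fun he => h.c_notMem (he ▸ haX)
  have hda' : d ≠ a := fun he => h.d_notMem (he ▸ haX)
  have hab := h2.2.2.1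
  have haS := h.subset haX
  have hadja : H.Adj d a := (hda a haX).2 rfl
  have hcS := h.nb.1
  have hdS := h.nb.2.1
  have hb : b = c ∨ (b ∈ X ∧ ∀ w ∈ X, H.Adj c w ↔ w = b) := by
    by_cases hbc : c = b
    · exact Or.inl hbc.symm
    · right
      have hset : X ∪ {c, d, z} = X ∪ {d, c, z} := by rw [Set.insert_comm]
      obtain ⟨c', hc'X, hc', huniq⟩ :=
        h.swap.exists_unique_adj hS hs (hset ▸ h2) hv₀ hv₀' hca hbc
      rcases hc' with rfl | rfl
      · -- `c` and `d` have the same single neighbour in `X`, a cut vertex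
        exfalso
        by_cases hX : X ⊆ {c'}
        · obtain rfl : v₀ = c' := hX hv₀
          refine hv₀' c d ⟨hcS, hdS, hcd, fun w hw => ⟨fun hvw => ?_, ?_⟩⟩
          · rcases h.adj_mem hv₀ hw hvw with h1 | h1
            · obtain rfl : w = v₀ := hX h1
              exact absurd hvw (H.loopless.irrefl _)
            · exact h1
          · rintro (rfl | rfl)
            · exact ((huniq v₀ hv₀).2 rfl).symm
            · exact hadja.symm
        · obtain ⟨t, ht, hta⟩ := Set.not_subset.1 hX
          refine hS.false_of_closedIn (T := X \ {c'}) (v := c') (w := c) hcS hca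
            (fun t ht => h.subset ht.1) (fun hf => hf.2 rfl) ⟨t, ht, hta⟩ ?_
            (fun hc => h.c_notMem hc.1)
          intro u hu w hw huw
          refine ⟨?_, hw.2⟩
          rcases h.adj_mem hu.1 hw.1 huw with h1 | rfl | rfl
          · exact h1
          · exact absurd ((huniq u hu.1).1 huw.symm) hu.2
          · exact absurd ((hda u hu.1).1 huw.symm) hu.2
      · exact ⟨hc'X, huniq⟩
  have hbS : b ∈ S := by
    rcases hb with rfl | hb
    · exact hcS
    · exact h.subset hb.1
  have hdb' : ¬ H.Adj d b := by
    rcases hb with rfl | hb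
    · exact fun hh => h.not_adj hh.symm
    · exact fun hh => hab ((hda b hb.1).1 hh).symm
  have hcnb : ∀ w ∈ X, w ≠ b → H.Adj c w → b = c := fun w hw hwb hcw => by
    rcases hb with hb | hb
    · exact hb
    · exact absurd ((hb.2 w hw).1 hcw) hwb
  -- the remaining vertices of `X` are common neighbours of `a` and `b`
  have hP : ∀ p ∈ X, p ≠ a → p ≠ b → HasNeighbors H S p a b := by
    intro p hp hpa hpb
    obtain ⟨x, y, hxy⟩ := h2.2.2.2 p (Or.inl hp) hpa hpb
    have hn := h.hasNeighbors hp hxy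
    have hor : ∀ e ∈ S, H.Adj p e → (∃ f, HasNeighbors H S p e f) → e = a ∨ e = b := by
      rintro e he hpe ⟨f, hf⟩
      rcases h.adj_mem hp he hpe with h1 | rfl | rfl
      · by_contra! hne
        obtain ⟨x', y', hxy'⟩ := h2.2.2.2 e (Or.inl h1) hne.1 hne.2
        exact hs.not_hasNeighbors hS (h.subset hp) hf _ _ (h.hasNeighbors h1 hxy')
      · exact Or.inr (hcnb p hp hpb hpe.symm).symm
      · exact absurd ((hda p hp).1 hpe.symm) hpa
    have hx := hor x hn.1 hn.left ⟨y, hn⟩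
    have hy := hor y hn.2.1 hn.right ⟨x, hn.swap⟩
    have hne := hn.2.2.1
    rcases hx with rfl | rfl <;> rcases hy with rfl | rfl
    · exact absurd rfl hne
    · exact hn
    · exact hn.swap
    · exact absurd rfl hne
  have hv₀ab : v₀ = a ∨ v₀ = b := by
    by_contra! hne
    exact hv₀' _ _ (hP v₀ hv₀ hne.1 hne.2)
  have haN : ∀ w ∈ S, H.Adj a w → w = d ∨ w = b ∨ (w ∈ X ∧ w ≠ a ∧ w ≠ b) := by
    intro w hw haw
    have hwa := haw.ne'
    by_cases hwb : w = b
    · exact Or.inr (Or.inl hwb)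
    · rcases h.adj_mem haX hw haw with h1 | rfl | rfl
      · exact Or.inr (Or.inr ⟨h1, hwa, hwb⟩)
      · exact Or.inr (Or.inl (hcnb a haX hab haw.symm).symm)
      · exact Or.inl rfl
  have hbN : b ≠ c → ∀ w ∈ S, H.Adj b w → w = c ∨ w = a ∨ (w ∈ X ∧ w ≠ a ∧ w ≠ b) := by
    intro hbc w hw hbw
    have hwb := hbw.ne'
    obtain ⟨hbX, -⟩ := hb.resolve_left hbc
    by_cases hwa : w = a
    · exact Or.inr (Or.inl hwa)
    · rcases h.adj_mem hbX hw hbw with h1 | rfl | rfl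
      · exact Or.inr (Or.inr ⟨h1, hwa, hwb⟩)
      · exact Or.inl rfl
      · exact absurd hbw.symm hdb'
  have hcb : b ≠ c → H.Adj c b := fun hbc =>
    ((hb.resolve_left hbc).2 b (hb.resolve_left hbc).1).2 rfl
  have hbc_of : v₀ = b → b ≠ c := fun hv hbc => h.c_notMem (hbc ▸ hv ▸ hv₀)
  have hnab : ¬ H.Adj a b := by
    intro hadj
    have hempty : ∀ w, ¬ (w ∈ X ∧ w ≠ a ∧ w ≠ b) := fun w hw =>
      (hs w (h.subset hw.1) a b (hP w hw.1 hw.2.1 hw.2.2)).1 hadj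
    rcases hv₀ab with rfl | rfl
    · refine hv₀' d b ⟨hdS, hbS, hdb, fun w hw => ⟨fun haw => ?_, ?_⟩⟩
      · have := haN w hw haw
        have := hempty w
        tauto
      · rintro (rfl | rfl)
        · exact hadja.symm
        · exact hadj
    · have hbc := hbc_of rfl
      refine hv₀' c a ⟨hcS, haS, hca, fun w hw => ⟨fun haw => ?_, ?_⟩⟩
      · have := hbN hbc w hw haw
        have := hempty w
        tauto
      · rintro (rfl | rfl)
        · exact (hcb hbc).symm
        · exact hadj.symm
  have hnac : ¬ H.Adj a c := fun hac => by
    have := hcnb a haX hab hac.symm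
    exact hnab (this ▸ hac)
  obtain ⟨p, hp⟩ : ∃ p, p ∈ X ∧ p ≠ a ∧ p ≠ b := by
    by_contra! hno
    refine hS.false_of_closedIn (T := {a}) (v := d) (w := b) hbS hdb.symm (by simpa)
      (by simpa using hda') ⟨a, rfl⟩ ?_ (by simpa using hab.symm)
    rintro u rfl w hw huw
    rcases haN w hw.1 huw with rfl | rfl | h1
    · exact absurd rfl hw.2
    · exact absurd huw hnab
    · exact absurd (hno w h1.1 h1.2.1) h1.2.2
  obtain ⟨q, hq, hqp⟩ : ∃ q, (q ∈ X ∧ q ≠ a ∧ q ≠ b) ∧ q ≠ p := by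
    by_contra! hno
    have hpn := hP p hp.1 hp.2.1 hp.2.2
    rcases hv₀ab with rfl | rfl
    · refine hv₀' d p ⟨hdS, h.subset hp.1, fun he => h.d_notMem (he ▸ hp.1),
        fun w hw => ⟨fun haw => ?_, ?_⟩⟩
      · rcases haN w hw haw with h1 | rfl | h1
        · exact Or.inl h1
        · exact absurd haw hnab
        · exact Or.inr (hno w h1)
      · rintro (rfl | rfl)
        · exact hadja.symm
        · exact hpn.left.symm
    · have hbc := hbc_of rfl
      refine hv₀' c p ⟨hcS, h.subset hp.1, fun he => h.c_notMem (he ▸ hp.1),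
        fun w hw => ⟨fun haw => ?_, ?_⟩⟩
      · rcases hbN hbc w hw haw with h1 | rfl | h1
        · exact Or.inl h1
        · exact absurd haw.symm hnab
        · exact Or.inr (hno w h1)
      · rintro (rfl | rfl)
        · exact (hcb hbc).symm
        · exact hpn.right.symm
  have hpn := hP p hp.1 hp.2.1 hp.2.2
  have hqn := hP q hq.1 hq.2.1 hq.2.2
  have hM : Linked H ({b} ∪ {c}) := by
    by_cases hbc : b = c
    · subst hbc
      simpa using linked_singleton b
    · exact (linked_singleton b).union (linked_singleton c) (.of_adj rfl rfl (hcb hbc).symm)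
  obtain ⟨yc, hyc, hcy⟩ := hY.c_adj
  obtain ⟨yd, hyd, hdy⟩ := hY.d_adj
  rw [Set.disjoint_left] at hXY
  have hza : z ≠ a := fun he => h.z_notMem (he ▸ haX)
  have hzd := h.nb.right.ne
  have hzc := h.nb.left.ne
  have hpc : p ≠ c := fun he => h.c_notMem (he ▸ hp.1)
  have hpd : p ≠ d := fun he => h.d_notMem (he ▸ hp.1)
  have hqc : q ≠ c := fun he => h.c_notMem (he ▸ hq.1)
  have hqd : q ≠ d := fun he => h.d_notMem (he ▸ hq.1)
  have hzb : z ≠ b := by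
    rcases hb with rfl | hb
    · exact hzc
    · exact fun he => h.z_notMem (he ▸ hb.1)
  have hzq : z ≠ q := fun he => h.z_notMem (he ▸ hq.1)
  refine ⟨{a}, {d}, {b} ∪ {c} ∪ {p} ∪ {z}, {b} ∪ {c} ∪ {q} ∪ Y, ⟨by simpa, by simpa, ?_, ?_⟩,
    ⟨linked_singleton _, linked_singleton _,
      (hM.union (linked_singleton p) (.of_adj (Or.inl rfl) rfl hpn.right.symm)).union
        (linked_singleton z) (.of_adj (Or.inl (Or.inr rfl)) rfl h.nb.left.symm),
      (hM.union (linked_singleton q) (.of_adj (Or.inl rfl) rfl hqn.right.symm)).union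
        hY.linked (.of_adj (Or.inl (Or.inr rfl)) hyc hcy)⟩,
    ⟨by simpa using hda'.symm, ?_, ?_, ?_, ?_⟩,
    ⟨.of_adj rfl rfl hadja.symm, .of_adj rfl (Or.inl (Or.inr rfl)) hpn.left.symm,
      .of_adj rfl (Or.inl (Or.inr rfl)) hqn.left.symm,
      .of_adj rfl (Or.inr rfl) h.nb.right.symm, .of_adj rfl (Or.inr hyd) hdy,
      Or.inl ⟨b, by simp, by simp⟩⟩, ?_⟩
  · rintro v (((rfl | rfl) | rfl) | rfl)
    exacts [hbS, hcS, h.subset hp.1, h.z_mem]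
  · rintro v (((rfl | rfl) | rfl) | hv)
    exacts [hbS, hcS, h.subset hq.1, hY.subset hv]
  · rw [Set.disjoint_singleton_left]
    rintro (((rfl | rfl) | rfl) | rfl)
    exacts [hab rfl, hca rfl, hp.2.1 rfl, hza rfl]
  · rw [Set.disjoint_singleton_left]
    rintro (((rfl | rfl) | rfl) | hv)
    exacts [hab rfl, hca rfl, hq.2.1 rfl, hXY haX hv]
  · rw [Set.disjoint_singleton_left]
    rintro (((rfl | rfl) | rfl) | rfl)
    exacts [hdb rfl, hcd rfl, hpd rfl, hzd rfl]
  · rw [Set.disjoint_singleton_left]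
    rintro (((rfl | rfl) | rfl) | hv)
    exacts [hdb rfl, hcd rfl, hqd rfl, hY.d_notMem hv]
  · rintro m ⟨hm1, hm2⟩
    have hm : m = b ∨ m = c := by
      rcases hm1 with ((h1 | h1) | rfl) | rfl
      · exact Or.inl h1
      · exact Or.inr h1
      · rcases hm2 with ((h1 | h1) | h1) | h1
        exacts [Or.inl h1, Or.inr h1, absurd h1.symm hqp, absurd h1 (hXY hp.1)]
      · rcases hm2 with ((h1 | h1) | h1) | h1
        exacts [Or.inl h1, Or.inr h1, absurd h1 hzq, absurd h1 hY.z_notMem]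
    rintro v (rfl | rfl) hadj <;> rcases hm with rfl | rfl
    exacts [hnab hadj.symm, hnac hadj.symm, hdb' hadj.symm, h.not_adj hadj]

/-! ### The two alternatives -/

/-- The induction step at a vertex `z` of degree two with neighbours `c` and `d`: outside of
`c`, `d`, `z` there are a component with a vertex of larger degree and one further component, and
these two lobes give a half embedding. -/
theorem hasHalfEmbedding_of_unsuppressible (hS : NoCliqueSep H S) (hs : Unsuppressible H S)
    (hsub : ∀ S' ⊂ S, S'.Nontrivial → NoCliqueSep H S' → ∃ a b, TwoBranch H S' a b)
    (h2 : ∀ a b, ¬ TwoBranch H S a b) (hz : z ∈ S) (hnb : HasNeighbors H S z c d) :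
    HasHalfEmbedding H S := by
  obtain ⟨hcd, hlk⟩ := hs z hz c d hnb
  obtain ⟨v₀, hv₀, hv₀c, hv₀d, hv₀'⟩ : ∃ v₀ ∈ S, v₀ ≠ c ∧ v₀ ≠ d ∧
      ∀ x y, ¬ HasNeighbors H S v₀ x y := by
    by_contra! hno
    exact h2 c d ⟨hnb.1, hnb.2.1, hnb.2.2.1, hno⟩
  have hv₀z : v₀ ≠ z := fun he => hv₀' c d (he ▸ hnb)
  obtain ⟨X, hXS, hv₀X, hX, hXc⟩ :=
    exists_component H (S := S \ {c, d}) ⟨hv₀, by simp [hv₀c, hv₀d]⟩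
  have hzX : z ∉ X := fun hzX => hv₀z (hX.2 {z} (by simpa) ⟨z, rfl⟩ (by
    rintro u rfl w hw huw
    have h1 := hXS hw
    exact absurd ((hnb.2.2.2 w h1.1).1 huw) h1.2) hv₀X)
  have hXL := Lobe.of_component hS hz hnb hcd hXS hzX hX hXc
  obtain ⟨Y, hYR, hY, hYc, hv₀Y⟩ : ∃ Y ⊆ S \ {c, d, z}, Linked H Y ∧
      ClosedIn H (S \ {c, d, z}) Y ∧ v₀ ∉ Y := by
    obtain ⟨T, hT, ⟨t, ht⟩, hTc, w, hw, hwT⟩ :=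
      not_linked (S := S \ {c, d, z}) ⟨v₀, hv₀, by simp [hv₀c, hv₀d, hv₀z]⟩ hlk
    have key : ∀ W ⊆ S \ {c, d, z}, W.Nonempty → ClosedIn H (S \ {c, d, z}) W → v₀ ∉ W →
        ∃ Y ⊆ S \ {c, d, z}, Linked H Y ∧ ClosedIn H (S \ {c, d, z}) Y ∧ v₀ ∉ Y := by
      rintro W hW ⟨w, hw⟩ hWc hv
      obtain ⟨Y, hYW, -, hY, hYc⟩ := exists_component H hw
      exact ⟨Y, hYW.trans hW, hY, fun u hu v hv huv => hYc u hu v (hWc u (hYW hu) v hv huv) huv,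
        fun h => hv (hYW h)⟩
    by_cases hv₀T : v₀ ∈ T
    · exact key _ Set.sdiff_subset ⟨w, hw, hwT⟩ hTc.compl fun h => h.2 hv₀T
    · exact key T hT ⟨t, ht⟩ hTc hv₀T
  have hzY : z ∉ Y := fun h => (hYR h).2 (by simp)
  have hYS : Y ⊆ S \ {c, d} := fun v hv =>
    ⟨(hYR hv).1, fun h => (hYR hv).2 (by rcases h with rfl | rfl <;> simp)⟩
  have hYc' : ClosedIn H (S \ {c, d}) Y := by
    intro u hu v hv huv
    refine hYc u hu v ⟨hv.1, ?_⟩ huv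
    rintro (rfl | rfl | rfl)
    · exact hv.2 (by simp)
    · exact hv.2 (by simp)
    · exact (hYS hu).2 ((hnb.2.2.2 u (hYS hu).1).1 huv.symm)
  have hYL := Lobe.of_component hS hz hnb hcd hYS hzY hY hYc'
  have hXY : Disjoint X Y := by
    rw [Set.disjoint_left]
    intro v hvX hvY
    exact hv₀Y (hX.2 (X ∩ Y) Set.inter_subset_left ⟨v, hvX, hvY⟩
      (fun u hu w hw huw => ⟨hw, hYc' u hu.2 w (hXS hw) huw⟩) hv₀X).2
  have hlt : X ∪ {c, d, z} ⊂ S := by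
    refine ⟨Set.union_subset (fun v hv => (hXS hv).1)
      (by simp [Set.insert_subset_iff, hnb.1, hnb.2.1, hz]), fun hcon => ?_⟩
    obtain ⟨y, hy⟩ := hY.1
    rcases hcon (hYR hy).1 with h1 | h1
    · exact Set.disjoint_left.1 hXY h1 hy
    · exact (hYR hy).2 h1
  obtain ⟨a, b, hab⟩ := hsub _ hlt ⟨c, by simp, d, by simp, hnb.2.2.1⟩ (hXL.noCliqueSep hS)
  -- the attachment vertex `d` (or, by symmetry, `c`) is no branch vertex of the smaller graph
  have main : ∀ c d : V, Lobe H S z c d X → Lobe H S z c d Y →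
      TwoBranch H (X ∪ {c, d, z}) a b → d ≠ a → d ≠ b → HasHalfEmbedding H S := by
    intro c d hX hY hab hda hdb
    obtain ⟨d', hd'X, hd', huniq⟩ := hX.exists_unique_adj hS hs hab hv₀X hv₀' hda hdb
    rcases hd' with rfl | rfl
    · exact hX.hasHalfEmbedding hY hXY hS hs hab hv₀X hv₀' hdb hd'X huniq
    · exact hX.hasHalfEmbedding hY hXY hS hs hab.swap hv₀X hv₀' hda hd'X huniq
  by_cases hd : d ≠ a ∧ d ≠ b
  · exact main c d hXL hYL hab hd.1 hd.2
  · by_cases hc : c ≠ a ∧ c ≠ b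
    · exact main d c hXL.swap hYL.swap (by rwa [Set.insert_comm]) hc.1 hc.2
    · exfalso
      have hne := hnb.2.2.1
      obtain ⟨x, y, hxy⟩ := hab.2.2.2 v₀ (Or.inl hv₀X) (by grind) (by grind)
      exact hv₀' x y (hXL.hasNeighbors hv₀X hxy)

/-- A graph without clique separator has a half embedding, or all but two of its vertices have
degree two. -/
theorem hasHalfEmbedding_or_twoBranch (n : ℕ) : ∀ (H : SimpleGraph V) (S : Set V), S.Finite →
    S.ncard = n → S.Nontrivial → NoCliqueSep H S →
    HasHalfEmbedding H S ∨ ∃ a b, TwoBranch H S a b := by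
  induction n using Nat.strong_induction_on with
  | _ n ih =>
  intro H S hfin hn hne hS
  by_contra! hcon
  obtain ⟨hno, h2⟩ := hcon
  obtain ⟨x, hx, y', hy', hxy'⟩ := hne
  obtain ⟨x', hx', y, hy, -, hxy⟩ := (hS.linked ⟨x, hx⟩).exists_adj (T := {x}) (by simpa)
    ⟨x, rfl⟩ hy' (by simpa using hxy'.symm)
  obtain rfl : x' = x := hx'
  have hthird : ∃ v ∈ S, v ≠ x' ∧ v ≠ y := by
    by_contra! hno3
    exact h2 x' y ⟨hx, hy, hxy.ne, fun v hv h1 h3 => absurd (hno3 v hv h1) h3⟩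
  obtain ⟨z, hz, -, -, c, d, hzcd⟩ :=
    exists_degree_le_two n H S x' y hfin hn hx hy hxy hthird (hS.linked ⟨x', hx⟩) hno
  have hne : S.Nontrivial := ⟨x', hx, y', hy', hxy'⟩
  obtain ⟨hnb, -⟩ := hS.neighbors_of_degree_le_two hne h2 hz hzcd
  have hs : Unsuppressible H S := by
    intro v hv e f hn'
    have hef := (hS.neighbors_of_degree_le_two hne h2 hv fun w hw => (hn'.2.2.2 w hw).1).2
    refine ⟨hef, fun hlk => ?_⟩
    rcases ih _ (hn ▸ Set.ncard_sdiff_singleton_lt_of_mem hv hfin) (merge H e v) (S \ {v})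
      (hfin.subset Set.sdiff_subset) rfl
      ⟨e, ⟨hn'.1, hn'.left.ne'⟩, f, ⟨hn'.2.1, hn'.right.ne'⟩, hn'.2.2.1⟩
      (hS.merge hv hn' hlk hno) with h1 | ⟨a, b, hab⟩
    · exact hno (h1.of_merge hv hn'.left.symm)
    · exact h2 a b (hab.of_merge hv hn' hef)
  refine hno (hasHalfEmbedding_of_unsuppressible hS hs (fun S' hS' hne' hsep => ?_) h2 hz hnb)
  exact (ih _ (hn ▸ Set.ncard_lt_ncard hS' hfin) H S' (hfin.subset hS'.1) rfl hne'
    hsep).resolve_left fun h => hno (h.mono hS'.1)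

/-! ### Graphs with at most two branch vertices -/

/-- The subgraph induced by `S` is the union of the paths `g i 0, …, g i (ℓ i)` from `a` to `b`,
which are disjoint except for their ends; at most one of them is a single edge. -/
structure IsPathSystem {ι : Type} (H : SimpleGraph V) (S : Set V) (a b : V) (ℓ : ι → ℕ)
    (g : ι → ℕ → V) : Prop where
  ne : a ≠ b
  pos : ∀ i, 1 ≤ ℓ i
  one_unique : ∀ i j, ℓ i = 1 → ℓ j = 1 → i = j
  start : ∀ i, g i 0 = a
  finish : ∀ i, g i (ℓ i) = b
  inner_ne : ∀ i j, 0 < j → j < ℓ i → g i j ≠ a ∧ g i j ≠ b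
  inner_inj : ∀ i j i' j', 0 < j → j < ℓ i → 0 < j' → j' < ℓ i' → g i j = g i' j' →
    i = i' ∧ j = j'
  mem_iff : ∀ v, v ∈ S ↔ v = a ∨ v = b ∨ ∃ i j, 0 < j ∧ j < ℓ i ∧ v = g i j
  adj_iff : ∀ u ∈ S, ∀ v ∈ S, H.Adj u v ↔ ∃ i j, j < ℓ i ∧
    (u = g i j ∧ v = g i (j + 1) ∨ v = g i j ∧ u = g i (j + 1))

namespace IsPathSystem

variable {ι : Type} {ℓ : ι → ℕ} {g : ι → ℕ → V}

theorem mem (h : IsPathSystem H S a b ℓ g) {i : ι} {j : ℕ} (hj : j ≤ ℓ i) : g i j ∈ S := by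
  rw [h.mem_iff]
  rcases Nat.eq_zero_or_pos j with rfl | hj0
  · exact Or.inl (h.start i)
  · rcases hj.lt_or_eq with hj | rfl
    · exact Or.inr (Or.inr ⟨i, j, hj0, hj, rfl⟩)
    · exact Or.inr (Or.inl (h.finish i))

theorem eq_start (h : IsPathSystem H S a b ℓ g) {i : ι} {j : ℕ} (hj : j ≤ ℓ i)
    (hg : g i j = a) : j = 0 := by
  by_contra hj0
  rcases hj.lt_or_eq with hj | rfl
  · exact (h.inner_ne i j (Nat.pos_of_ne_zero hj0) hj).1 hg
  · exact h.ne (hg.symm.trans (h.finish i))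

theorem adj_succ (h : IsPathSystem H S a b ℓ g) {i : ι} {j : ℕ} (hj : j < ℓ i) :
    H.Adj (g i j) (g i (j + 1)) :=
  (h.adj_iff _ (h.mem hj.le) _ (h.mem hj)).2 ⟨i, j, hj, Or.inl ⟨rfl, rfl⟩⟩

/-- A common neighbour of `a` and `b` is one more path, of length two. -/
theorem add_path (h : IsPathSystem H (S \ {z}) a b ℓ g) (hz : z ∈ S)
    (hnb : HasNeighbors H S z a b) :
    IsPathSystem H S a b (fun i : Option ι => i.elim 2 ℓ)
      (fun i : Option ι => i.elim (fun j => if j = 0 then a else if j = 1 then z else b) g) where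
  ne := h.ne
  pos := by
    rintro (_ | i)
    · simp
    · exact h.pos i
  one_unique := by
    rintro (_ | i) (_ | j) h1 h2
    · rfl
    · simp at h1
    · simp at h2
    · exact congrArg some (h.one_unique i j h1 h2)
  start := by
    rintro (_ | i)
    · simp
    · exact h.start i
  finish := by
    rintro (_ | i)
    · simp
    · exact h.finish i
  inner_ne := by
    rintro (_ | i) j hj hj'
    · obtain rfl : j = 1 := by simp at hj'; omega
      simpa using ⟨hnb.left.ne, hnb.right.ne⟩
    · exact h.inner_ne i j hj hj'
  inner_inj := by
    have hz' : ∀ i j, 0 < j → j < ℓ i → g i j ≠ z := fun i j _ hj hg => (h.mem hj.le).2 hg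
    rintro (_ | i) j (_ | i') j' hj hj' hk hk' hg
    · simp at hj' hk'
      exact ⟨rfl, by omega⟩
    · obtain rfl : j = 1 := by simp at hj'; omega
      exact absurd (by simpa using hg.symm) (hz' i' j' hk hk')
    · obtain rfl : j' = 1 := by simp at hk'; omega
      exact absurd (by simpa using hg) (hz' i j hj hj')
    · obtain ⟨rfl, rfl⟩ := h.inner_inj i j i' j' hj hj' hk hk' hg
      exact ⟨rfl, rfl⟩
  mem_iff v := by
    by_cases hvz : v = z
    · subst hvz
      simp only [hz, true_iff]
      exact Or.inr (Or.inr ⟨none, 1, by simp, by simp, by simp⟩)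
    · have hv : v ∈ S ↔ v ∈ S \ {z} := by simp [hvz]
      rw [hv, h.mem_iff]
      refine or_congr Iff.rfl (or_congr Iff.rfl ⟨?_, ?_⟩)
      · rintro ⟨i, j, hj⟩
        exact ⟨some i, j, hj⟩
      · rintro ⟨_ | i, j, hj, hj', hv⟩
        · obtain rfl : j = 1 := by simp at hj'; omega
          exact absurd (by simpa using hv) hvz
        · exact ⟨i, j, hj, hj', hv⟩
  adj_iff u hu v hv := by
    constructor
    · intro huv
      by_cases huz : u = z
      · subst huz
        rcases (hnb.2.2.2 v hv).1 huv with rfl | rfl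
        · exact ⟨none, 0, by simp, by simp⟩
        · exact ⟨none, 1, by simp, by simp⟩
      · by_cases hvz : v = z
        · subst hvz
          rcases (hnb.2.2.2 u hu).1 huv.symm with rfl | rfl
          · exact ⟨none, 0, by simp, by simp⟩
          · exact ⟨none, 1, by simp, by simp⟩
        · obtain ⟨i, j, hij⟩ := (h.adj_iff u ⟨hu, huz⟩ v ⟨hv, hvz⟩).1 huv
          exact ⟨some i, j, hij⟩
    · rintro ⟨_ | i, j, hj, hij⟩
      · have hj' : j = 0 ∨ j = 1 := by simp at hj; omega
        rcases hj' with rfl | rfl <;> rcases hij with ⟨rfl, rfl⟩ | ⟨rfl, rfl⟩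
        · simpa using hnb.left.symm
        · simpa using hnb.left
        · simpa using hnb.right
        · simpa using hnb.right.symm
      · rcases hij with ⟨rfl, rfl⟩ | ⟨rfl, rfl⟩
        · exact h.adj_succ hj
        · exact (h.adj_succ hj).symm

open Classical in
/-- Subdividing the first edge of a path by a vertex `z` lengthens this path by one. -/
theorem subdivide (h : IsPathSystem (merge H a z) (S \ {z}) a b ℓ g) (hz : z ∈ S)
    (hnb : HasNeighbors H S z a d) (had : ¬ H.Adj a d) (hdb : d ≠ b) :
    ∃ ℓ' g', IsPathSystem (ι := ι) H S a b ℓ' g' := by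
  have hda : d ≠ a := hnb.2.2.1.symm
  have haz := hnb.left.ne'
  have hdz := hnb.right.ne'
  have haS : a ∈ S \ {z} := ⟨hnb.1, haz⟩
  have hdS : d ∈ S \ {z} := ⟨hnb.2.1, hdz⟩
  have hbz : b ≠ z := fun hb => ((h.mem_iff b).2 (Or.inr (Or.inl rfl))).2 hb
  -- the path whose first edge is `ad`
  obtain ⟨i₀, hd, hℓ⟩ : ∃ i₀, g i₀ 1 = d ∧ 1 < ℓ i₀ := by
    obtain ⟨i, j, hj, ⟨h1, h2⟩ | ⟨h1, h2⟩⟩ :=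
      (h.adj_iff a haS d hdS).1 (Or.inr (Or.inl ⟨rfl, hda, hnb.right⟩))
    · obtain rfl := h.eq_start hj.le h1.symm
      refine ⟨i, h2.symm, lt_of_le_of_ne hj fun he => hdb ?_⟩
      rw [h2, ← h.finish i, ← he]
    · exact absurd (h.eq_start hj h2.symm) (Nat.succ_ne_zero j)
  let ℓ' : ι → ℕ := fun i => if i = i₀ then ℓ i + 1 else ℓ i
  let g' : ι → ℕ → V := fun i j =>
    if i = i₀ then (if j = 0 then a else if j = 1 then z else g i (j - 1)) else g i j
  have hℓ₀ : ℓ' i₀ = ℓ i₀ + 1 := by simp [ℓ']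
  have hℓ₁ : ∀ i, i ≠ i₀ → ℓ' i = ℓ i := fun i hi => by simp [ℓ', hi]
  have hg₀ : g' i₀ 0 = a := by simp [g']
  have hg₁ : g' i₀ 1 = z := by simp [g']
  have hg₂ : ∀ j, g' i₀ (j + 2) = g i₀ (j + 1) := fun j => by simp [g']
  have hg₃ : ∀ i, i ≠ i₀ → g' i = g i := fun i hi => by funext j; simp [g', hi]
  have hz' : ∀ i j, j ≤ ℓ i → g i j ≠ z := fun i j hj hg => (h.mem hj).2 hg
  refine ⟨ℓ', g', h.ne, ?_, ?_, ?_, ?_, ?_, ?_, ?_, ?_⟩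
  · intro i
    have := h.pos i
    simp only [ℓ']
    split_ifs <;> omega
  · intro i j hi hj
    have := h.pos i
    have := h.pos j
    simp only [ℓ'] at hi hj
    split_ifs at hi hj
    · omega
    · omega
    · omega
    · exact h.one_unique i j hi hj
  · intro i
    by_cases hi : i = i₀
    · rw [hi, hg₀]
    · rw [hg₃ i hi, h.start]
  · intro i
    by_cases hi : i = i₀
    · obtain ⟨m, hm⟩ : ∃ m, ℓ i₀ = m + 1 := ⟨ℓ i₀ - 1, by omega⟩
      rw [hi, hℓ₀, hm, hg₂, ← hm, h.finish]
    · rw [hg₃ i hi, hℓ₁ i hi, h.finish]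
  · intro i j hj hj'
    by_cases hi : i = i₀
    · subst hi
      rw [hℓ₀] at hj'
      obtain rfl | ⟨m, rfl⟩ : j = 1 ∨ ∃ m, j = m + 2 := by
        rcases j with _ | _ | m
        · omega
        · exact Or.inl rfl
        · exact Or.inr ⟨m, rfl⟩
      · rw [hg₁]
        exact ⟨haz.symm, hbz.symm⟩
      · rw [hg₂]
        exact h.inner_ne i (m + 1) (by omega) (by omega)
    · rw [hg₃ i hi]
      rw [hℓ₁ i hi] at hj'
      exact h.inner_ne i j hj hj'
  · -- an inner vertex is `z` or an inner vertex of the old system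
    have hold : ∀ i j, 0 < j → j < ℓ' i → (i = i₀ ∧ j = 1 ∧ g' i j = z) ∨
        ∃ m, 0 < m ∧ m < ℓ i ∧ g' i j = g i m ∧ j = if i = i₀ then m + 1 else m := by
      intro i j hj hj'
      by_cases hi : i = i₀
      · subst hi
        rw [hℓ₀] at hj'
        rcases j with _ | _ | m
        · omega
        · exact Or.inl ⟨rfl, rfl, hg₁⟩
        · exact Or.inr ⟨m + 1, by omega, by omega, hg₂ m, by simp⟩
      · rw [hℓ₁ i hi] at hj'
        exact Or.inr ⟨j, hj, hj', by rw [hg₃ i hi], by simp [hi]⟩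
    intro i j i' j' hj hj' hk hk' hg
    rcases hold i j hj hj' with ⟨e1, e2, e3⟩ | ⟨m, m1, m2, m3, m4⟩ <;>
      rcases hold i' j' hk hk' with ⟨f1, f2, f3⟩ | ⟨n, n1, n2, n3, n4⟩
    · exact ⟨e1.trans f1.symm, e2.trans f2.symm⟩
    · exact absurd (n3.symm.trans (hg.symm.trans e3)) (hz' i' n n2.le)
    · exact absurd (m3.symm.trans (hg.trans f3)) (hz' i m m2.le)
    · obtain ⟨rfl, rfl⟩ := h.inner_inj i m i' n m1 m2 n1 n2 (m3.symm.trans (hg.trans n3))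
      exact ⟨rfl, m4.trans n4.symm⟩
  · intro v
    by_cases hvz : v = z
    · subst hvz
      simp only [hz, true_iff]
      exact Or.inr (Or.inr ⟨i₀, 1, one_pos, by omega, hg₁.symm⟩)
    · have hv : v ∈ S ↔ v ∈ S \ {z} := by simp [hvz]
      rw [hv, h.mem_iff]
      refine or_congr Iff.rfl (or_congr Iff.rfl ⟨?_, ?_⟩)
      · rintro ⟨i, j, hj, hj', rfl⟩
        by_cases hi : i = i₀
        · subst hi
          obtain ⟨m, rfl⟩ : ∃ m, j = m + 1 := ⟨j - 1, by omega⟩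
          exact ⟨i, m + 2, by omega, by omega, (hg₂ m).symm⟩
        · exact ⟨i, j, hj, by rwa [hℓ₁ i hi], by rw [hg₃ i hi]⟩
      · rintro ⟨i, j, hj, hj', hvg⟩
        by_cases hi : i = i₀
        · subst hi
          rcases j with _ | _ | m
          · omega
          · exact absurd (hvg.trans hg₁) hvz
          · exact ⟨i, m + 1, by omega, by omega, hvg.trans (hg₂ m)⟩
        · rw [hℓ₁ i hi] at hj'
          exact ⟨i, j, hj, hj', by rw [hvg, hg₃ i hi]⟩
  · intro u hu v hv
    -- an edge of the old system other than the first edge `ad` of the path `i₀`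
    have hedge : ∀ i j, j < ℓ i → ¬ (i = i₀ ∧ j = 0) → H.Adj (g i j) (g i (j + 1)) := by
      intro i j hj hij
      rcases adj_of_merge_adj_of_hasNeighbors hnb (h.mem hj.le).1 (h.mem hj).1
        (h.adj_succ hj) with h1 | ⟨h1, h2⟩ | ⟨h1, h2⟩
      · exact h1
      · obtain rfl := h.eq_start hj.le h1
        have hlt : 0 + 1 < ℓ i := lt_of_le_of_ne hj fun he => hdb (by
          rw [← h2, ← h.finish i, ← he])
        exact absurd ⟨(h.inner_inj i 1 i₀ 1 one_pos hlt one_pos hℓ (h2.trans hd.symm)).1, rfl⟩ hij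
      · exact absurd (h.eq_start hj h2) (Nat.succ_ne_zero j)
    constructor
    · intro huv
      by_cases huz : u = z
      · subst huz
        rcases (hnb.2.2.2 v hv).1 huv with rfl | rfl
        · exact ⟨i₀, 0, by omega, Or.inr ⟨hg₀.symm, hg₁.symm⟩⟩
        · exact ⟨i₀, 1, by omega, Or.inl ⟨hg₁.symm, ((hg₂ 0).trans hd).symm⟩⟩
      · by_cases hvz : v = z
        · subst hvz
          rcases (hnb.2.2.2 u hu).1 huv.symm with rfl | rfl
          · exact ⟨i₀, 0, by omega, Or.inl ⟨hg₀.symm, hg₁.symm⟩⟩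
          · exact ⟨i₀, 1, by omega, Or.inr ⟨hg₁.symm, ((hg₂ 0).trans hd).symm⟩⟩
        · obtain ⟨i, j, hj, hij⟩ := (h.adj_iff u ⟨hu, huz⟩ v ⟨hv, hvz⟩).1 (Or.inl huv)
          by_cases hi : i = i₀
          · subst hi
            rcases j with _ | m
            · rw [h.start, zero_add, hd] at hij
              rcases hij with ⟨rfl, rfl⟩ | ⟨rfl, rfl⟩
              · exact absurd huv had
              · exact absurd huv.symm had
            · exact ⟨i, m + 2, by omega, by rwa [hg₂ m, hg₂ (m + 1)]⟩
          · exact ⟨i, j, by rwa [hℓ₁ i hi], by rwa [hg₃ i hi]⟩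
    · rintro ⟨i, j, hj, hij⟩
      have huv : H.Adj (g' i j) (g' i (j + 1)) := by
        by_cases hi : i = i₀
        · subst hi
          rcases j with _ | _ | m
          · rw [hg₀, zero_add, hg₁]
            exact hnb.left.symm
          · have := hg₂ 0
            rw [zero_add, hg₁, this, zero_add, hd]
            exact hnb.right
          · rw [hg₂ m, hg₂ (m + 1)]
            exact hedge i (m + 1) (by omega) (by simp)
        · rw [hg₃ i hi]
          rw [hℓ₁ i hi] at hj
          exact hedge i j hj (by simp [hi])
      rcases hij with ⟨rfl, rfl⟩ | ⟨rfl, rfl⟩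
      · exact huv
      · exact huv.symm

end IsPathSystem

/-- A graph in which all vertices but `a` and `b` have degree two, and which stays connected
without `a` and without `b`, is a system of paths from `a` to `b`. -/
theorem exists_isPathSystem (n : ℕ) : ∀ (H : SimpleGraph V) (S : Set V), S.Finite →
    S.ncard = n → TwoBranch H S a b → Linked H (S \ {a}) → Linked H (S \ {b}) →
    ∃ (ι : Type) (_ : Finite ι) (ℓ : ι → ℕ) (g : ι → ℕ → V), IsPathSystem H S a b ℓ g := by
  induction n using Nat.strong_induction_on with
  | _ n ih =>
  intro H S hfin hn h2 hSa hSb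
  have hab := h2.2.2.1
  by_cases hex : ∃ z ∈ S, z ≠ b ∧ H.Adj a z
  · obtain ⟨z, hz, hzb, haz⟩ := hex
    obtain ⟨d, hnb⟩ : ∃ d, HasNeighbors H S z a d := by
      obtain ⟨p, q, hpq⟩ := h2.2.2.2 z hz haz.ne' hzb
      rcases (hpq.2.2.2 a h2.1).1 haz.symm with rfl | rfl
      · exact ⟨q, hpq⟩
      · exact ⟨p, hpq.swap⟩
    have hdz := hnb.right.ne'
    have hlt := hn ▸ Set.ncard_sdiff_singleton_lt_of_mem hz hfin
    have hcomm : ∀ v : V, (S \ {z}) \ {v} = (S \ {v}) \ {z} := fun v => by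
      rw [Set.sdiff_sdiff_comm]
    by_cases hdb : d = b
    · subst hdb
      obtain ⟨ι, hι, ℓ, g, hg⟩ := ih _ hlt H (S \ {z}) (hfin.subset Set.sdiff_subset) rfl
        ⟨⟨h2.1, haz.ne⟩, ⟨h2.2.1, hzb.symm⟩, hab, fun v hv hva hvb => by
          obtain ⟨p, q, hpq⟩ := h2.2.2.2 v hv.1 hva hvb
          have hvz : ¬ H.Adj v z := fun hvz => by
            rcases (hnb.2.2.2 v hv.1).1 hvz.symm with rfl | rfl
            · exact hva rfl
            · exact hvb rfl
          exact ⟨p, q, ⟨hpq.1, fun he => hvz (he ▸ hpq.left)⟩,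
            ⟨hpq.2.1, fun he => hvz (he ▸ hpq.right)⟩, hpq.2.2.1, fun w hw => hpq.2.2.2 w hw.1⟩⟩
        (by
          rw [hcomm]
          exact hSa.remove_leaf ⟨h2.2.1, hab.symm⟩ hdz fun w hw hzw =>
            ((hnb.2.2.2 w hw.1).1 hzw).resolve_left hw.2)
        (by
          rw [hcomm]
          exact hSb.remove_leaf ⟨h2.1, hab⟩ haz.ne fun w hw hzw =>
            ((hnb.2.2.2 w hw.1).1 hzw).resolve_right hw.2)
      exact ⟨Option ι, inferInstance, _, _, hg.add_path hz hnb⟩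
    · have hda : d ≠ a := hnb.2.2.1.symm
      obtain ⟨e, he⟩ : ∃ e, HasNeighbors H S d z e := by
        obtain ⟨p, q, hpq⟩ := h2.2.2.2 d hnb.2.1 hda hdb
        rcases (hpq.2.2.2 z hz).1 hnb.right.symm with rfl | rfl
        · exact ⟨q, hpq⟩
        · exact ⟨p, hpq.swap⟩
      have hea : e ≠ a := by
        rintro rfl
        -- otherwise `e` separates `z` and `d` from `b`
        have := hSa.2 {z, d} (by
          simp only [Set.insert_subset_iff, Set.singleton_subset_iff]
          exact ⟨⟨hz, haz.ne'⟩, ⟨hnb.2.1, hda⟩⟩) ⟨z, by simp⟩ (by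
          rintro u (rfl | rfl) w hw huw
          · exact Or.inr (((hnb.2.2.2 w hw.1).1 huw).resolve_left hw.2)
          · exact Or.inl (((he.2.2.2 w hw.1).1 huw).resolve_right hw.2)) ⟨h2.2.1, hab.symm⟩
        rcases this with h1 | h1
        · exact hzb h1.symm
        · exact hdb h1.symm
      have had : ¬ H.Adj a d := fun had => by
        rcases (he.2.2.2 a h2.1).1 had.symm with h1 | h1
        · exact haz.ne h1
        · exact hea h1.symm
      obtain ⟨ι, hι, ℓ, g, hg⟩ := ih _ hlt (merge H a z) (S \ {z})
        (hfin.subset Set.sdiff_subset) rfl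
        ⟨⟨h2.1, haz.ne⟩, ⟨h2.2.1, hzb.symm⟩, hab, fun v hv hva hvb => by
          by_cases hvd : v = d
          · subst hvd
            refine ⟨a, e, ⟨h2.1, haz.ne⟩, ⟨he.2.1, he.2.2.1.symm⟩, hea.symm, fun w hw => ?_⟩
            constructor
            · intro hvw
              rcases adj_of_merge_adj_of_hasNeighbors hnb hv.1 hw.1 hvw with h1 | h1 | h1
              · exact Or.inr (((he.2.2.2 w hw.1).1 h1).resolve_left hw.2)
              · exact absurd h1.1 hva
              · exact Or.inl h1.2
            · rintro (rfl | rfl)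
              · exact Or.inr (Or.inr ⟨rfl, hva, hnb.right⟩)
              · exact Or.inl he.right
          · obtain ⟨p, q, hpq⟩ := h2.2.2.2 v hv.1 hva hvb
            have hvz : ¬ H.Adj v z := fun hvz => by
              rcases (hnb.2.2.2 v hv.1).1 hvz.symm with rfl | rfl
              · exact hva rfl
              · exact hvd rfl
            refine ⟨p, q, ⟨hpq.1, fun he => hvz (he ▸ hpq.left)⟩,
              ⟨hpq.2.1, fun he => hvz (he ▸ hpq.right)⟩, hpq.2.2.1, fun w hw => ?_⟩
            rw [← hpq.2.2.2 w hw.1]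
            refine ⟨fun hvw => ?_, Or.inl⟩
            exact (adj_of_merge_adj_of_hasNeighbors hnb hv.1 hw.1 hvw).resolve_right (by tauto)⟩
        (by
          rw [hcomm]
          exact (hSa.remove_leaf (d := d) ⟨hnb.2.1, hda⟩ hdz fun w hw hzw =>
            ((hnb.2.2.2 w hw.1).1 hzw).resolve_left hw.2).congr fun _ _ _ _ h => Or.inl h)
        (by
          rw [hcomm]
          exact hSb.contract ⟨h2.1, hab⟩ haz)
      obtain ⟨ℓ', g', hg'⟩ := hg.subdivide hz hnb had hdb
      exact ⟨ι, hι, ℓ', g', hg'⟩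
  · push Not at hex
    have hS : ∀ v ∈ S, v = a ∨ v = b := fun v hv => by
      by_cases hvb : v = b
      · exact Or.inr hvb
      · exact Or.inl (hSb.2 {a} (by simpa using ⟨h2.1, hab⟩) ⟨a, rfl⟩ (by
          rintro u rfl w hw huw
          exact absurd huw (hex w hw.1 hw.2)) ⟨hv, hvb⟩)
    -- there is one path of length one if `a` and `b` are adjacent, and no path otherwise
    refine ⟨PLift (H.Adj a b), inferInstance, fun _ => 1, fun _ j => if j = 0 then a else b, hab,
      fun _ => le_rfl, fun i j _ _ => Subsingleton.elim i j, fun _ => rfl, fun _ => rfl,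
      fun i j hj hj' => absurd hj' (by omega), fun i j i' j' hj hj' => absurd hj' (by omega),
      fun v => ⟨fun hv => (hS v hv).imp_right Or.inl, ?_⟩, fun u hu v hv => ⟨fun huv => ?_, ?_⟩⟩
    · rintro (rfl | rfl | ⟨i, j, hj, hj', -⟩)
      · exact h2.1
      · exact h2.2.1
      · omega
    · rcases hS u hu with rfl | rfl <;> rcases hS v hv with rfl | rfl
      · exact absurd huv (H.loopless.irrefl _)
      · exact ⟨⟨huv⟩, 0, one_pos, by simp⟩
      · exact ⟨⟨huv.symm⟩, 0, one_pos, by simp⟩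
      · exact absurd huv (H.loopless.irrefl _)
    · rintro ⟨⟨i⟩, j, hj, hij⟩
      obtain rfl : j = 0 := by omega
      rcases hij with ⟨rfl, rfl⟩ | ⟨rfl, rfl⟩
      · simpa using i
      · simpa using i.symm

/-- The vertex of a path system named by a node of the abstract `P`-graph. -/
def pNodeVertex {k : ℕ} {ℓ : Fin k → ℕ} (a b : V) (g : Fin k → ℕ → V) : PNode ℓ → V
  | .start => a
  | .finish => b
  | .inner i j _ => g i j

theorem IsPathSystem.isPGraph {ι : Type} [Finite ι] {ℓ : ι → ℕ} {g : ι → ℕ → V}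
    (h : IsPathSystem H Set.univ a b ℓ g) (hconn : Linked H Set.univ) : IsPGraph H := by
  obtain ⟨k, ⟨e⟩⟩ := Finite.exists_equiv_fin ι
  let ℓ' : Fin k → ℕ := fun i => ℓ (e.symm i)
  let f : PNode ℓ' → V := pNodeVertex a b fun i => g (e.symm i)
  have hpath : ∀ i j, j ≤ ℓ' i → f (pathNode ℓ' i j) = g (e.symm i) j := by
    intro i j hj
    unfold pathNode
    split_ifs with h0 h1
    · rw [h0, h.start]
      rfl
    · rfl
    · rw [show j = ℓ (e.symm i) from le_antisymm hj (not_lt.1 h1), h.finish]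
      rfl
  have hinj : Function.Injective f := by
    rintro (_ | _ | ⟨i, j, hj⟩) (_ | _ | ⟨i', j', hj'⟩) huv
    · rfl
    · exact absurd huv h.ne
    · exact absurd huv.symm (h.inner_ne _ _ hj'.1 hj'.2).1
    · exact absurd huv.symm h.ne
    · rfl
    · exact absurd huv.symm (h.inner_ne _ _ hj'.1 hj'.2).2
    · exact absurd huv (h.inner_ne _ _ hj.1 hj.2).1
    · exact absurd huv (h.inner_ne _ _ hj.1 hj.2).2
    · obtain ⟨hi, rfl⟩ := h.inner_inj _ _ _ _ hj.1 hj.2 hj'.1 hj'.2 huv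
      obtain rfl := e.symm.injective hi
      rfl
  have hsurj : Function.Surjective f := by
    intro v
    rcases (h.mem_iff v).1 (Set.mem_univ v) with rfl | rfl | ⟨i, j, hj, hj', rfl⟩
    · exact ⟨.start, rfl⟩
    · exact ⟨.finish, rfl⟩
    · refine ⟨.inner (e i) j ⟨hj, by simpa [ℓ'] using hj'⟩, ?_⟩
      simp [f, pNodeVertex]
  have hadj : ∀ u v, H.Adj (f u) (f v) ↔ (pGraph ℓ').Adj u v := by
    intro u v
    rw [h.adj_iff _ (Set.mem_univ _) _ (Set.mem_univ _), pGraph, SimpleGraph.fromRel_adj]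
    constructor
    · rintro ⟨i, j, hj, hij⟩
      have hj' : j < ℓ' (e i) := by simpa [ℓ'] using hj
      have h1 : f (pathNode ℓ' (e i) j) = g i j := by rw [hpath _ _ hj'.le, e.symm_apply_apply]
      have h2 : f (pathNode ℓ' (e i) (j + 1)) = g i (j + 1) := by
        rw [hpath _ _ hj', e.symm_apply_apply]
      have hne := (h.adj_succ hj).ne
      rw [← h1, ← h2] at hij hne
      rcases hij with ⟨h3, h4⟩ | ⟨h3, h4⟩
      · obtain rfl := hinj h3
        obtain rfl := hinj h4
        exact ⟨fun he => hne (congrArg f he), Or.inl ⟨e i, j, hj', rfl, rfl⟩⟩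
      · obtain rfl := hinj h3
        obtain rfl := hinj h4
        exact ⟨fun he => hne (congrArg f he.symm), Or.inr ⟨e i, j, hj', rfl, rfl⟩⟩
    · rintro ⟨-, ⟨i, j, hj, rfl, rfl⟩ | ⟨i, j, hj, rfl, rfl⟩⟩
      · exact ⟨e.symm i, j, hj, Or.inl ⟨hpath i j hj.le, hpath i (j + 1) hj⟩⟩
      · exact ⟨e.symm i, j, hj, Or.inr ⟨hpath i j hj.le, hpath i (j + 1) hj⟩⟩
  refine ⟨k, ℓ', ?_, fun i => h.pos _, fun i j hi hj => e.symm.injective (h.one_unique _ _ hi hj),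
    ⟨(SimpleGraph.Iso.symm ⟨Equiv.ofBijective f ⟨hinj, hsurj⟩, fun {u v} => hadj u v⟩)⟩⟩
  -- connectedness gives an edge and hence a path
  obtain ⟨u, -, v, -, -, huv⟩ := hconn.exists_adj (T := {a}) (Set.subset_univ _) ⟨a, rfl⟩
    (Set.mem_univ b) h.ne.symm
  obtain ⟨i, -⟩ := (h.adj_iff u (Set.mem_univ _) v (Set.mem_univ _)).1 huv
  exact (e i).pos

end CliqueEmb

theorem mainTheorem6 {V : Type*} [Finite V] (H : SimpleGraph V)
    (hH : CliqueEmb.IsPattern H)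
    (hsep : ¬ ∃ C : Set V, CliqueEmb.IsCliqueSeparator H C) :
    2 ≤ CliqueEmb.clemb H ∨ CliqueEmb.IsPGraph H := by
  have hS : CliqueEmb.NoCliqueSep H Set.univ := by
    intro K _ hK hne
    rw [CliqueEmb.linked_iff_connected, ← Set.compl_eq_univ_sdiff]
    by_contra hcon
    exact hsep ⟨K, Set.ssubset_univ_iff.2 hne, hK, hcon⟩
  have hnt : (Set.univ : Set V).Nontrivial := by
    have := Finite.one_lt_card_iff_nontrivial.1 hH.two_le_card
    exact Set.nontrivial_univ
  rcases CliqueEmb.hasHalfEmbedding_or_twoBranch _ H Set.univ Set.finite_univ rfl hnt hS with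
    h | ⟨a, b, hab⟩
  · exact Or.inl h.two_le_clemb
  · right
    obtain ⟨ι, hι, ℓ, g, hg⟩ := CliqueEmb.exists_isPathSystem _ H Set.univ Set.finite_univ rfl hab
      (hS.linked_sdiff_singleton a hab.2.1 hab.2.2.1.symm)
      (hS.linked_sdiff_singleton b hab.1 hab.2.2.1)
    exact hg.isPGraph (hS.linked ⟨a, Set.mem_univ a⟩)
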